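/- Let $n\ge 2$. Fix homogeneous coordinates on $\mathbb P_n$ and consider formal series $a=\sum_{j\ge0}a_jt^j$ with $a_j\in\mathbb C^{n+1}$. A parametrised smooth arc is such a series with $a_0\wedge a_1\ne0$, and a (smooth) germ $(\mathcal C,O)$, $O=[a_0]$, is the class of a parametrised smooth arc modulo the changes $a(t)\mapsto u(t)\,a(v(t))$, where $u,v\in\mathbb C[[t]]$, $u(0)\neq0$, $v(0)=0$, $v'(0)\ne0$. A differential invariant of bidegree $(\delta,\varpi)\in\mathbb Z^2$ on $\mathbb P_n$ is an $SL_{n+1}(\mathbb C)$-invariant polynomial $I$ in the coordinates of the $a_j$ such that $I(u\cdot(a\circ v))=u(0)^{\delta}v'(0)^{\varpi}I(a)$ for all such $a,u,v$. Let $\mathcal H_n$ be the $\mathbb C$-algebra of differential invariants, i.e. the sum of these spaces over all bidegrees; the elements of these spaces are called bihomogeneous. The bihomogeneous invariant $I$ has reduced bidegree $(d,p)\in\mathbb Z^2$ if it has bidegree $\bigl((n+1)d,\;p+\binom{n+1}{2}d\bigr)$. An element $I\in\mathcal H_n$ vanishes on a germ if $I(a)=0$ for every parametrised arc $a$ representing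 it (for bihomogeneous $I$ one representative suffices). If a germ $(\mathcal C,O)$ in $\mathbb P_{n+1}$ is represented by $\sum a_jt^j$ with $a_0\wedge a_1\wedge a_2\neq0$, its projection from $O$ is the germ in $\mathbb P(\mathbb C^{n+2}/\mathbb Ca_0)\cong\mathbb P_n$ represented by $\sum_{j\ge0}\bar a_{j+1}t^{j}$, where $\bar a_j$ is the class of $a_j$ modulo $\mathbb Ca_0$. Then there is an injective homomorphism of $\mathbb C$-algebras $\iota_n:\mathcal H_n\to\mathcal H_{n+1}$ with the following property: $(*)$ for every $I\in\mathcal H_n$ and every germ $(\mathcal C,O)$ in $\mathbb P_{n+1}$ with $a_0\wedge a_1\wedge a_2\ne0$, $\iota_n(I)$ vanishes on $(\mathcal C,O)$ if and only if $I$ vanishes on the projection of $(\mathcal C,O)$ from $O$. Moreover $\iota_n$ preserves the reduced bidegree. It is characterised by $(*)$ up to the evident rescalings: if $\varphi:\mathcal H_n\to\mathcal H_{n+1}$ is any homomorphism of $\mathbb C$-algebras that has property $(*)$ and carries bihomogeneous invariants to bihomogeneous invariants, then there are $s,t\in\mathbb C^{*}$ such that $\varphi(I)=s^{d}t^{p}\,\iota_n(I)$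 for every $I\in\mathcal H_n$ of reduced bidegree $(d,p)$. -/

import Mathlib

noncomputable section

namespace DiffInv

/-- The space `Aᵛ ⊗ ℂ[[t]]` for an `(n+1)`-dimensional space `A` of linear forms on `ℙ_n` with chosen
coordinates `X_0, …, X_n`: vectors of `n + 1` formal power series. -/
abbrev Series (n : ℕ) : Type := Fin (n + 1) → PowerSeries ℂ

/-- The vector `a_j` of a series `a = ∑ a_j t ^ j`. -/
def coeffVec {n : ℕ} (j : ℕ) (a : Series n) : Fin (n + 1) → ℂ :=
  fun i => PowerSeries.coeff j (a i)

/-- The smoothness condition `a_0 ∧ a_1 ≠ 0`. -/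
def IsSmooth {n : ℕ} (a : Series n) : Prop :=
  LinearIndependent ℂ ![coeffVec 0 a, coeffVec 1 a]

/-- Parametrised smooth arcs in `ℙ_n`. -/
def ParamArc (n : ℕ) : Type := {a : Series n // IsSmooth a}

/-- Elements of `G_0`: power series with non-zero constant term. -/
def IsUnitSeries (u : PowerSeries ℂ) : Prop :=
  PowerSeries.coeff 0 u ≠ 0

/-- Elements of `G_1`: power series beginning with a non-zero term of degree one. -/
def IsParamChange (v : PowerSeries ℂ) : Prop :=
  PowerSeries.coeff 0 v = 0 ∧ PowerSeries.coeff 1 v ≠ 0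

/-- The action of `(u, v) ∈ G_0 ⋊ G_1`: the series `a(t)` becomes `u(t) a(v(t))`. -/
def reparam {n : ℕ} (u v : PowerSeries ℂ) (a : Series n) : Series n :=
  fun i => u * PowerSeries.subst v (a i)

/-- `b` is obtained from `a` by the action of an element of `G`. -/
def SameOrbit {n : ℕ} (a b : ParamArc n) : Prop :=
  ∃ u v : PowerSeries ℂ, IsUnitSeries u ∧ IsParamChange v ∧ b.1 = reparam u v a.1

/-- Smooth arcs (germs of smooth curves) in `ℙ_n`: parametrised smooth arcs modulo `G`. Since `G` is
a group, the classes of the equivalence relation generated by `SameOrbit` are the `G`-orbits. -/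
def Arc (n : ℕ) : Type := Quot (SameOrbit (n := n))

/-- The germ represented by a parametrised smooth arc. -/
def ParamArc.germ {n : ℕ} (a : ParamArc n) : Arc n := Quot.mk _ a

/-- Polynomial functions on `Aᵛ ⊗ ℂ[[t]]`, in the coordinates `a_{ij}` (the coefficient of `t ^ j` in
the `i`-th coordinate). For `n ≥ 2` these are also the regular functions on the open set of
parametrised smooth arcs, whose complement has codimension at least two. -/
abbrev PolyFun (n : ℕ) : Type := MvPolynomial (Fin (n + 1) × ℕ) ℂ

/-- The value of a polynomial function at a series. -/
def evalAt {n : ℕ} (a : Series n) (f : PolyFun n) : ℂ :=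
  MvPolynomial.eval (fun ij => coeffVec ij.2 a ij.1) f

/-- The global sections of the line bundle `𝒪(δ, ϖ)` on the space of smooth arcs: the functions
that the action of `(u, v) ∈ G` multiplies by the character `u_0 ^ δ * v_1 ^ ϖ`. -/
def sections (n : ℕ) (δ ϖ : ℤ) : Submodule ℂ (PolyFun n) where
  carrier := {f | ∀ (a : Series n) (u v : PowerSeries ℂ), IsSmooth a → IsUnitSeries u →
    IsParamChange v → evalAt (reparam u v a) f =
      PowerSeries.coeff 0 u ^ δ * PowerSeries.coeff 1 v ^ ϖ * evalAt a f}
  add_mem' := by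
    intro f g hf hg a u v ha hu hv
    have h1 := hf a u v ha hu hv
    have h2 := hg a u v ha hu hv
    simp only [evalAt, map_add] at h1 h2 ⊢
    rw [h1, h2]; ring
  zero_mem' := by
    intro a u v _ _ _
    simp [evalAt]
  smul_mem' := by
    intro c f hf a u v ha hu hv
    have h1 := hf a u v ha hu hv
    simp only [evalAt, MvPolynomial.smul_eval] at h1 ⊢
    rw [h1]; ring

/-- The linear action of a matrix on the coordinates of a series. -/
def linAct {n : ℕ} (g : Matrix (Fin (n + 1)) (Fin (n + 1)) ℂ) (a : Series n) : Series n :=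
  fun i => ∑ j, g i j • a j

/-- The differential invariants of degree `δ` and weight `ϖ` on `ℙ_n`: the sections of `𝒪(δ, ϖ)`
which are invariant under the special linear group. -/
def invariants (n : ℕ) (δ ϖ : ℤ) : Submodule ℂ (PolyFun n) where
  carrier := {f | f ∈ sections n δ ϖ ∧
    ∀ (g : Matrix.SpecialLinearGroup (Fin (n + 1)) ℂ) (a : Series n), IsSmooth a →
      evalAt (linAct g.1 a) f = evalAt a f}
  add_mem' := by
    rintro f g ⟨hf, hf'⟩ ⟨hg, hg'⟩
    refine ⟨add_mem hf hg, fun s a ha => ?_⟩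
    have h1 := hf' s a ha
    have h2 := hg' s a ha
    simp only [evalAt, map_add] at h1 h2 ⊢
    rw [h1, h2]
  zero_mem' := ⟨zero_mem _, fun s a _ => by simp [evalAt]⟩
  smul_mem' := by
    rintro c f ⟨hf, hf'⟩
    refine ⟨Submodule.smul_mem _ c hf, fun s a ha => ?_⟩
    have h1 := hf' s a ha
    simp only [evalAt, MvPolynomial.smul_eval] at h1 ⊢
    rw [h1]

/-- Invariants of bidegrees `(δ, ϖ)` and `(δ', ϖ')` have a product of bidegree
`(δ + δ', ϖ + ϖ')`. -/
theorem mul_mem_invariants {n : ℕ} {δ ϖ δ' ϖ' : ℤ} {f g : PolyFun n}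
    (hf : f ∈ invariants n δ ϖ) (hg : g ∈ invariants n δ' ϖ') :
    f * g ∈ invariants n (δ + δ') (ϖ + ϖ') := by
  obtain ⟨hf1, hf2⟩ := hf
  obtain ⟨hg1, hg2⟩ := hg
  refine ⟨fun a u v ha hu hv => ?_, fun s a ha => ?_⟩
  · have h1 := hf1 a u v ha hu hv
    have h2 := hg1 a u v ha hu hv
    simp only [evalAt, map_mul] at h1 h2 ⊢
    rw [h1, h2, zpow_add₀ hu, zpow_add₀ hv.2]; ring
  · have h1 := hf2 s a ha
    have h2 := hg2 s a ha
    simp only [evalAt, map_mul] at h1 h2 ⊢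
    rw [h1, h2]

/-- Constants are invariants of bidegree `(0, 0)`. -/
theorem one_mem_invariants (n : ℕ) : (1 : PolyFun n) ∈ invariants n 0 0 :=
  ⟨fun a u v _ _ _ => by simp [evalAt], fun s a _ => by simp [evalAt]⟩

/-- The ring `ℋ_n` of differential invariants on `ℙ_n`: the sum, over all bidegrees `(δ, ϖ)`, of the
spaces of differential invariants of bidegree `(δ, ϖ)`. -/
def invariantRing (n : ℕ) : Subalgebra ℂ (PolyFun n) :=
  (⨆ e : ℤ × ℤ, invariants n e.1 e.2).toSubalgebra
    (Submodule.mem_iSup_of_mem (p := fun e : ℤ × ℤ => invariants n e.1 e.2) (0, 0)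
      (one_mem_invariants n))
    (by
      intro x y hx hy
      induction hx using Submodule.iSup_induction' with
      | mem e x hx =>
        induction hy using Submodule.iSup_induction' with
        | mem e' y hy =>
          exact Submodule.mem_iSup_of_mem (p := fun e : ℤ × ℤ => invariants n e.1 e.2)
            (e.1 + e'.1, e.2 + e'.2) (mul_mem_invariants hx hy)
        | zero => rw [mul_zero]; exact zero_mem _
        | add y z _ _ h1 h2 => rw [mul_add]; exact add_mem h1 h2
      | zero => rw [zero_mul]; exact zero_mem _
      | add x z _ _ h1 h2 => rw [add_mul]; exact add_mem h1 h2)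

/-- `I` is bihomogeneous: a differential invariant of some degree and some weight. -/
def IsBihomogeneous {n : ℕ} (I : invariantRing n) : Prop :=
  ∃ δ ϖ : ℤ, (I : PolyFun n) ∈ invariants n δ ϖ

/-- `I` is a differential invariant of reduced bidegree `(d, p)`: its degree is `(n + 1) d` and its
weight is `p + (n + 1 choose 2) d`. -/
def HasReducedBidegree {n : ℕ} (I : invariantRing n) (d p : ℤ) : Prop :=
  (I : PolyFun n) ∈ invariants n ((n + 1 : ℤ) * d) (p + ((n + 1).choose 2 : ℤ) * d)

/-- `I` vanishes on the germ `c`: it vanishes at every parametrised arc that represents `c`. For a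
bihomogeneous `I` it is the same to ask for one such parametrised arc. -/
def VanishesOn {n : ℕ} (I : invariantRing n) (c : Arc n) : Prop :=
  ∀ a : ParamArc n, a.germ = c → evalAt a.1 (I : PolyFun n) = 0

/-- The germ `c'` in `ℙ_n` is the projection of the germ `c = (𝒞, O)` in `ℙ_{n+1}` from the point
`O`, in some homogeneous coordinates on the projective space of lines through `O`.
If `c` is represented by `∑ a_j t ^ j`, then `O = [a_0]` and `c'` is represented by
`∑ π(a_{j+1}) t ^ j`, where `π` is the quotient map by the line `ℂ a_0` followed by coordinates on the
quotient. Such a `c'` exists, as a smooth arc, exactly when `a_0 ∧ a_1 ∧ a_2 ≠ 0`. -/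
def IsProjectionFromPoint {n : ℕ} (c : Arc (n + 1)) (c' : Arc n) : Prop :=
  ∃ (a : ParamArc (n + 1)) (b : ParamArc n)
    (π : (Fin (n + 1 + 1) → ℂ) →ₗ[ℂ] (Fin (n + 1) → ℂ)),
    a.germ = c ∧ b.germ = c' ∧
    LinearMap.ker π = Submodule.span ℂ {coeffVec 0 a.1} ∧
    ∀ j : ℕ, coeffVec j b.1 = π (coeffVec (j + 1) a.1)

/-- For every `I`, the invariant `φ I` vanishes on a germ `(𝒞, O)` if and only if `I` vanishes on the
projection of this germ from `O`. -/
def HasProjectionProperty {n : ℕ} (φ : invariantRing n →ₐ[ℂ] invariantRing (n + 1)) : Prop :=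
  ∀ (I : invariantRing n) (c : Arc (n + 1)) (c' : Arc n), IsProjectionFromPoint c c' →
    (VanishesOn (φ I) c ↔ VanishesOn I c')

end DiffInv

end

noncomputable section

namespace DiffInv

/-! Existence. A unimodular matrix moves the initial point `a_0` to the first basis vector; dropping
the first coordinate and dividing the others by `t` then gives the projected arc. Two such matrices
differ by one whose lower block has determinant one, so the value of an invariant on the projected
arc does not depend on the choice. In the chart `a_00 ≠ 0` this value is a polynomial divided by a
power of `a_00`; comparison with a second chart removes the denominator (`exists_isLift`). Following
the scaling of `a_0` through the block determinant gives the bidegree (`IsLift.mem_invariants`), and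
`liftHom` is the resulting homomorphism.

Uniqueness. Let `ψ I` be the restriction of `φ I` to the arcs `slice b = (1, t b)`, whose projection
is `b`. The projection property says that `ψ I` and `I` have the same zeros among smooth `b`, for
bihomogeneous `I`. Applied to `I - z J`, with `z` the value of `I / J` at a point, this gives `ψ I *
J = ψ J * I` whenever `I` and `J` have the same bidegree (`slicedHom_mul_comm`): the quotient `ψ I /
I` depends on the bidegree only.

This quotient is constant because no prime `q` occurs in it. If `q` does not divide `I`, it does not
divide `ψ I`, by the Nullstellensatz and because non-smooth series have codimension at least two. If
`q` divides `I`, then `q` is itself an invariant, and a power of `I` is compared with monomials in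
two invariants prime to `q` whose bidegrees are linearly independent (`emultiplicity_slicedHom`).
Such invariants come from the osculants, the Wronskians of the monomials of degree `m`: their ratio
of weight to degree tends to infinity with `m` as `n ≥ 2`, even after all factors `q` are removed
(`exists_steep_not_dvd`).

So `φ I = c • liftHom I` with `c` a multiplicative function of the reduced bidegree. It extends to a
character of `ℤ × ℤ` because `ℂˣ` is divisible, and a character has the form `s ^ d * t ^ p`. -/

/-- The series with prescribed coordinates. -/
def ofCoords {n : ℕ} (x : Fin (n + 1) × ℕ → ℂ) : Series n :=
  fun i => PowerSeries.mk fun j => x (i, j)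

@[simp] lemma coeffVec_ofCoords {n : ℕ} (x : Fin (n + 1) × ℕ → ℂ) (j : ℕ) (i : Fin (n + 1)) :
    coeffVec j (ofCoords x) i = x (i, j) := by
  simp [coeffVec, ofCoords]

lemma evalAt_ofCoords {n : ℕ} (x : Fin (n + 1) × ℕ → ℂ) (f : PolyFun n) :
    evalAt (ofCoords x) f = MvPolynomial.eval x f := by
  simp [evalAt]

/-! ### Polynomial functions on series, polynomial maps and Zariski density -/

section evalAt

variable {n : ℕ} (a : Series n) (f g : PolyFun n)

@[simp] lemma evalAt_add : evalAt a (f + g) = evalAt a f + evalAt a g := map_add _ _ _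
@[simp] lemma evalAt_sub : evalAt a (f - g) = evalAt a f - evalAt a g := map_sub _ _ _
@[simp] lemma evalAt_mul : evalAt a (f * g) = evalAt a f * evalAt a g := map_mul _ _ _
@[simp] lemma evalAt_zero : evalAt a (0 : PolyFun n) = 0 := map_zero _
@[simp] lemma evalAt_pow (k : ℕ) : evalAt a (f ^ k) = evalAt a f ^ k := map_pow _ _ _
@[simp] lemma evalAt_C (c : ℂ) : evalAt a (MvPolynomial.C c) = c := MvPolynomial.eval_C _
@[simp] lemma evalAt_smul (c : ℂ) : evalAt a (c • f) = c * evalAt a f :=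
  MvPolynomial.smul_eval _ _ _
@[simp] lemma evalAt_X (i : Fin (n + 1)) (j : ℕ) :
    evalAt a (MvPolynomial.X (i, j)) = PowerSeries.coeff j (a i) := MvPolynomial.eval_X _
@[simp] lemma evalAt_sum {ι : Type*} (s : Finset ι) (F : ι → PolyFun n) :
    evalAt a (∑ i ∈ s, F i) = ∑ i ∈ s, evalAt a (F i) := map_sum _ _ _

end evalAt

lemma eq_of_evalAt {n : ℕ} {f g : PolyFun n} (h : ∀ a, evalAt a f = evalAt a g) : f = g :=
  MvPolynomial.funext fun x => by
    rw [← evalAt_ofCoords, ← evalAt_ofCoords, h]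

lemma exists_evalAt_ne_zero {n : ℕ} {f : PolyFun n} (h : f ≠ 0) : ∃ a, evalAt a f ≠ 0 := by
  by_contra! H
  exact h (eq_of_evalAt fun a => by simp [H a])

/-- Polynomial functions that agree on a principal open set are equal. -/
lemma eq_of_evalAt_of_ne_zero {n : ℕ} {f g h : PolyFun n} (hh : h ≠ 0)
    (H : ∀ a, evalAt a h ≠ 0 → evalAt a f = evalAt a g) : f = g := by
  have : h * (f - g) = 0 := eq_of_evalAt fun a => by
    by_cases h0 : evalAt a h = 0
    · simp [h0]
    · simp [H a h0]
  rcases mul_eq_zero.1 this with h1 | h1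
  · exact absurd h1 hh
  · exact sub_eq_zero.1 h1

/-- A map between spaces of series whose coordinates are polynomial functions. -/
def IsPolyMap {n m : ℕ} (T : Series n → Series m) : Prop :=
  ∀ i j, ∃ F : PolyFun n, ∀ a, PowerSeries.coeff j (T a i) = evalAt a F

lemma IsPolyMap.exists_pullback {n m : ℕ} {T : Series n → Series m} (hT : IsPolyMap T)
    (f : PolyFun m) : ∃ g : PolyFun n, ∀ a, evalAt a g = evalAt (T a) f := by
  choose F hF using hT
  refine ⟨MvPolynomial.bind₁ (fun ij => F ij.1 ij.2) f, fun a => ?_⟩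
  induction f using MvPolynomial.induction_on with
  | C c => simp
  | add p q hp hq => simp only [map_add, evalAt_add, hp, hq]
  | mul_X p ij hp =>
    obtain ⟨i, j⟩ := ij
    simp only [map_mul, evalAt_mul, hp, MvPolynomial.bind₁_X_right, evalAt_X, hF]

/-- An identity between pullbacks of polynomial functions extends from a principal open set. -/
lemma IsPolyMap.evalAt_eq {n m m' : ℕ} {T : Series n → Series m} {T' : Series n → Series m'}
    (hT : IsPolyMap T) (hT' : IsPolyMap T') {h : PolyFun n} (hh : h ≠ 0)
    {f : PolyFun m} {g : PolyFun m'} {c : ℂ}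
    (H : ∀ a, evalAt a h ≠ 0 → evalAt (T a) f = c * evalAt (T' a) g) (a : Series n) :
    evalAt (T a) f = c * evalAt (T' a) g := by
  obtain ⟨f', hf⟩ := hT.exists_pullback f
  obtain ⟨g', hg⟩ := hT'.exists_pullback g
  have := eq_of_evalAt_of_ne_zero (f := f') (g := c • g') hh (fun b hb => by
    rw [evalAt_smul, hf, hg, H b hb])
  rw [← hf, ← hg, this, evalAt_smul]

lemma IsPolyMap.id {n : ℕ} : IsPolyMap (fun a : Series n => a) :=
  fun i j => ⟨MvPolynomial.X (i, j), fun a => by simp⟩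

lemma IsPolyMap.linAct {n : ℕ} (g : Matrix (Fin (n + 1)) (Fin (n + 1)) ℂ) :
    IsPolyMap (linAct g) :=
  fun i j => ⟨∑ k, g i k • MvPolynomial.X (k, j), fun a => by simp [DiffInv.linAct]⟩

/-! ### Reparametrisations in coordinates, and transformation laws beyond smooth series -/

lemma hasSubst_of_coeff_zero {v : PowerSeries ℂ} (hv : PowerSeries.coeff 0 v = 0) :
    PowerSeries.HasSubst v :=
  PowerSeries.HasSubst.of_constantCoeff_zero' (by simpa using hv)

lemma coeff_pow_eq_zero {v : PowerSeries ℂ} (hv : PowerSeries.coeff 0 v = 0) {d e : ℕ}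
    (h : e < d) : PowerSeries.coeff e (v ^ d) = 0 := by
  obtain ⟨w, rfl⟩ := PowerSeries.X_dvd_iff.2 (by simpa using hv)
  rw [mul_pow, PowerSeries.coeff_X_pow_mul', if_neg (by omega)]

lemma coeff_subst_eq_sum {v : PowerSeries ℂ} (hv : PowerSeries.coeff 0 v = 0)
    (f : PowerSeries ℂ) (e : ℕ) : PowerSeries.coeff e (PowerSeries.subst v f) =
      ∑ d ∈ Finset.range (e + 1), PowerSeries.coeff d f * PowerSeries.coeff e (v ^ d) := by
  rw [PowerSeries.coeff_subst' (hasSubst_of_coeff_zero hv)]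
  rw [finsum_eq_sum_of_support_subset (s := Finset.range (e + 1))]
  · simp
  · intro d hd
    simp only [Function.mem_support, smul_eq_mul] at hd
    by_contra h
    simp only [Finset.coe_range, Set.mem_Iio, not_lt] at h
    exact hd (by rw [coeff_pow_eq_zero hv (by omega), mul_zero])

lemma coeff_reparam {n : ℕ} {v : PowerSeries ℂ} (hv : PowerSeries.coeff 0 v = 0)
    (u : PowerSeries ℂ) (a : Series n) (i : Fin (n + 1)) (j : ℕ) :
    PowerSeries.coeff j (reparam u v a i) =
      ∑ k ∈ Finset.HasAntidiagonal.antidiagonal j, PowerSeries.coeff k.1 u *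
        ∑ d ∈ Finset.range (k.2 + 1), PowerSeries.coeff d (a i) * PowerSeries.coeff k.2 (v ^ d) := by
  simp [reparam, PowerSeries.coeff_mul, coeff_subst_eq_sum hv]

lemma IsPolyMap.reparam {n : ℕ} {v : PowerSeries ℂ} (hv : PowerSeries.coeff 0 v = 0)
    (u : PowerSeries ℂ) : IsPolyMap (reparam (n := n) u v) :=
  fun i j => ⟨∑ k ∈ Finset.HasAntidiagonal.antidiagonal j, PowerSeries.coeff k.1 u •
    ∑ d ∈ Finset.range (k.2 + 1), PowerSeries.coeff k.2 (v ^ d) • MvPolynomial.X (i, d),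
    fun a => by simp [coeff_reparam hv, mul_comm]⟩

/-- The Plücker coordinates of `a_0 ∧ a_1`. -/
def wedge (n : ℕ) (k l : Fin (n + 1)) : PolyFun n :=
  MvPolynomial.X (k, 0) * MvPolynomial.X (l, 1) - MvPolynomial.X (l, 0) * MvPolynomial.X (k, 1)

lemma isSmooth_of_evalAt_wedge {n : ℕ} {a : Series n} {k l : Fin (n + 1)}
    (h : evalAt a (wedge n k l) ≠ 0) : IsSmooth a := by
  rw [IsSmooth, LinearIndependent.pair_iff]
  intro s t hst
  have h1 := congrFun hst k
  have h2 := congrFun hst l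
  simp only [Pi.add_apply, Pi.smul_apply, smul_eq_mul, Pi.zero_apply, coeffVec] at h1 h2
  simp only [wedge, evalAt_sub, evalAt_mul, evalAt_X] at h
  constructor
  · refine (mul_eq_zero.1 (?_ : s * _ = 0)).resolve_right h
    linear_combination PowerSeries.coeff 1 (a l) * h1 - PowerSeries.coeff 1 (a k) * h2
  · refine (mul_eq_zero.1 (?_ : t * _ = 0)).resolve_right h
    linear_combination PowerSeries.coeff 0 (a k) * h2 - PowerSeries.coeff 0 (a l) * h1

lemma wedge_ne_zero {n : ℕ} {k l : Fin (n + 1)} (hkl : k ≠ l) : wedge n k l ≠ 0 := by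
  intro h
  have := congrArg (evalAt (ofCoords fun ij => if ij = (k, 0) ∨ ij = (l, 1) then 1 else 0)) h
  simp [wedge, ofCoords, hkl, hkl.symm] at this

lemma wedge_zero_last_ne_zero {n : ℕ} (hn : 0 < n) : wedge n 0 (Fin.last n) ≠ 0 :=
  wedge_ne_zero (by simp [Fin.ext_iff]; omega)

/-- Smooth series contain a non-empty principal open set, given by a Plücker coordinate, and both
sides are polynomial in `a`. Smoothness can therefore be dropped from the transformation law. -/
lemma evalAt_reparam_of_mem {n : ℕ} (hn : 0 < n) {δ ϖ : ℤ} {f : PolyFun n}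
    (hf : f ∈ invariants n δ ϖ) (a : Series n) {u v : PowerSeries ℂ} (hu : IsUnitSeries u)
    (hv : IsParamChange v) : evalAt (reparam u v a) f =
      PowerSeries.coeff 0 u ^ δ * PowerSeries.coeff 1 v ^ ϖ * evalAt a f :=
  (IsPolyMap.reparam hv.1 u).evalAt_eq IsPolyMap.id (wedge_zero_last_ne_zero hn)
    (fun b hb => hf.1 b u v (isSmooth_of_evalAt_wedge hb) hu hv) a

lemma evalAt_linAct_of_mem {n : ℕ} (hn : 0 < n) {δ ϖ : ℤ} {f : PolyFun n}
    (hf : f ∈ invariants n δ ϖ) (a : Series n)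
    (g : Matrix.SpecialLinearGroup (Fin (n + 1)) ℂ) :
    evalAt (linAct g.1 a) f = evalAt a f := by
  have := (IsPolyMap.linAct g.1).evalAt_eq IsPolyMap.id (c := 1) (g := f)
    (wedge_zero_last_ne_zero hn)
    (fun b hb => by rw [one_mul]; exact hf.2 g b (isSmooth_of_evalAt_wedge hb)) a
  rwa [one_mul] at this

/-! ### Functions without zeros along one-parameter families -/

/-- A family of series whose coordinates are polynomials in the parameter. -/
def IsPolyCurve {n : ℕ} (A : ℂ → Series n) : Prop :=
  ∀ i j, ∃ p : Polynomial ℂ, ∀ s, PowerSeries.coeff j (A s i) = p.eval s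

lemma IsPolyCurve.exists_polynomial {n : ℕ} {A : ℂ → Series n} (hA : IsPolyCurve A)
    (f : PolyFun n) : ∃ p : Polynomial ℂ, ∀ s, evalAt (A s) f = p.eval s := by
  choose F hF using hA
  refine ⟨MvPolynomial.aeval (fun ij => F ij.1 ij.2) f, fun s => ?_⟩
  induction f using MvPolynomial.induction_on with
  | C c => simp
  | add p q hp hq => simp only [map_add, evalAt_add, hp, hq, Polynomial.eval_add]
  | mul_X p ij hp =>
    obtain ⟨i, j⟩ := ij
    simp only [map_mul, evalAt_mul, hp, MvPolynomial.aeval_X, evalAt_X, hF, Polynomial.eval_mul]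

/-- A polynomial function without zeros on a polynomial curve is constant on it. -/
lemma IsPolyCurve.evalAt_eq {n : ℕ} {A : ℂ → Series n} (hA : IsPolyCurve A) {f : PolyFun n}
    (h : ∀ s, evalAt (A s) f ≠ 0) (s s' : ℂ) : evalAt (A s) f = evalAt (A s') f := by
  obtain ⟨p, hp⟩ := hA.exists_polynomial f
  have hdeg : p.degree = 0 := by
    by_contra hd
    obtain ⟨z, hz⟩ := IsAlgClosed.exists_root p hd
    exact h z (by rw [hp]; exact hz)
  rw [Polynomial.eq_C_of_degree_eq_zero hdeg] at hp
  simp [hp]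

/-- A polynomial over `ℂ` without zeros outside the origin has at most one term. -/
lemma coeff_mul_coeff_eq_zero {p : Polynomial ℂ} (h : ∀ s, s ≠ 0 → p.eval s ≠ 0) {k l : ℕ}
    (hkl : k ≠ l) : p.coeff k * p.coeff l = 0 := by
  have hp : p ≠ 0 := by
    rintro rfl
    exact h 1 one_ne_zero (by simp)
  obtain ⟨r, hr, hdvd⟩ := p.exists_eq_pow_rootMultiplicity_mul_and_not_dvd hp 0
  rw [Polynomial.C_0, sub_zero] at hr hdvd
  have hdeg : r.degree = 0 := by
    by_contra hd
    obtain ⟨z, hz⟩ := IsAlgClosed.exists_root r hd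
    rw [Polynomial.IsRoot.def] at hz
    rcases eq_or_ne z 0 with rfl | hz0
    · exact hdvd (Polynomial.X_dvd_iff.2 (by rwa [Polynomial.coeff_zero_eq_eval_zero]))
    · exact h z hz0 (by rw [hr]; simp [hz])
  rw [Polynomial.eq_C_of_degree_eq_zero hdeg] at hr
  rw [hr]
  simp only [Polynomial.coeff_mul_C, Polynomial.coeff_X_pow]
  split_ifs with h1 h2
  · exact absurd (h1.trans h2.symm) hkl
  all_goals simp

/-- The one-parameter group that acts on the coordinate `a_{ij}` with weight `w i j`. -/
def torus {n : ℕ} (w : Fin (n + 1) → ℕ → ℕ) (s : ℂ) (a : Series n) : Series n :=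
  fun i => PowerSeries.mk fun j => s ^ w i j * PowerSeries.coeff j (a i)

@[simp] lemma coeff_torus {n : ℕ} (w : Fin (n + 1) → ℕ → ℕ) (s : ℂ) (a : Series n)
    (i : Fin (n + 1)) (j : ℕ) : PowerSeries.coeff j (torus w s a i) =
      s ^ w i j * PowerSeries.coeff j (a i) := by
  simp [torus]

/-- A polynomial function which has no zeros on the torus orbits of the points of a principal open
set is homogeneous. -/
lemma exists_torus_weight {n : ℕ} (w : Fin (n + 1) → ℕ → ℕ) {f h : PolyFun n} (hh : h ≠ 0)
    (H : ∀ a, evalAt a h ≠ 0 → ∀ s, s ≠ 0 → evalAt (torus w s a) f ≠ 0) :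
    ∃ k : ℕ, ∀ a s, evalAt (torus w s a) f = s ^ k * evalAt a f := by
  -- `F` is `f` on the torus orbit of a generic point, as a polynomial in `s` over the ring of
  -- functions. At each point of the open set it specialises to a single monomial; since the ring is
  -- a domain, `F` is itself a monomial.
  set F : Polynomial (PolyFun n) := MvPolynomial.aeval
    (fun ij => Polynomial.C (MvPolynomial.X ij) * Polynomial.X ^ w ij.1 ij.2) f with hF
  have key (a : Series n) (s : ℂ) : (F.map (MvPolynomial.eval
      (fun ij => coeffVec ij.2 a ij.1))).eval s = evalAt (torus w s a) f := by
    rw [hF]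
    clear hF H
    clear F
    induction f using MvPolynomial.induction_on with
    | C c =>
      rw [MvPolynomial.aeval_C, evalAt_C, IsScalarTower.algebraMap_apply ℂ (PolyFun n)]
      simp [MvPolynomial.algebraMap_eq]
    | add p q hp hq => simp only [map_add, evalAt_add, ← hp, ← hq, Polynomial.eval_add,
        Polynomial.map_add]
    | mul_X p ij hp =>
      obtain ⟨i, j⟩ := ij
      simp only [map_mul, evalAt_mul, ← hp, MvPolynomial.aeval_X, evalAt_X, Polynomial.eval_mul,
        Polynomial.map_mul, Polynomial.map_C, Polynomial.map_pow, Polynomial.map_X,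
        Polynomial.eval_C, Polynomial.eval_pow, Polynomial.eval_X, MvPolynomial.eval_X, coeffVec,
        coeff_torus]
      ring
  have hcoeff {k l : ℕ} (hkl : k ≠ l) : F.coeff k * F.coeff l = 0 := by
    refine eq_of_evalAt_of_ne_zero hh fun a ha => ?_
    have := coeff_mul_coeff_eq_zero (p := F.map (MvPolynomial.eval
      (fun ij => coeffVec ij.2 a ij.1))) (fun s hs => by rw [key]; exact H a ha s hs) hkl
    simpa [evalAt] using this
  have hF0 : F ≠ 0 := by
    intro h0
    obtain ⟨a, ha⟩ := exists_evalAt_ne_zero hh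
    exact H a ha 1 one_ne_zero (by rw [← key, h0]; simp)
  have hmono : F = Polynomial.C F.leadingCoeff * Polynomial.X ^ F.natDegree := by
    ext1 k
    rw [Polynomial.coeff_C_mul, Polynomial.coeff_X_pow]
    split_ifs with hk
    · rw [hk, mul_one, Polynomial.leadingCoeff]
    · rw [mul_zero]
      exact (mul_eq_zero.1 (hcoeff hk)).resolve_right (by simpa using hF0)
  have key2 (a : Series n) (s : ℂ) :
      evalAt (torus w s a) f = s ^ F.natDegree * evalAt a F.leadingCoeff := by
    rw [← key, hmono]
    simp [evalAt, mul_comm, hF0]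
  refine ⟨F.natDegree, fun a s => ?_⟩
  have h1 := key2 a 1
  have : torus w 1 a = a := by
    ext i j
    simp
  rw [this, one_pow, one_mul] at h1
  rw [key2, h1]

/-! ### The linear action and generation of the special linear group by transvections -/

lemma linAct_mul {n : ℕ} (g g' : Matrix (Fin (n + 1)) (Fin (n + 1)) ℂ) (a : Series n) :
    linAct (g * g') a = linAct g (linAct g' a) := by
  funext i
  simp only [linAct, Matrix.mul_apply, Finset.sum_smul, Finset.smul_sum, mul_smul]
  rw [Finset.sum_comm]

lemma linAct_one {n : ℕ} (a : Series n) : linAct 1 a = a := by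
  funext i
  simp [linAct, Matrix.one_apply]

lemma coeff_linAct {n : ℕ} (g : Matrix (Fin (n + 1)) (Fin (n + 1)) ℂ) (a : Series n)
    (i : Fin (n + 1)) (j : ℕ) :
    PowerSeries.coeff j (linAct g a i) = ∑ k, g i k * PowerSeries.coeff j (a k) := by
  simp [linAct]

section Transvections

variable {ι : Type*} [DecidableEq ι] [Fintype ι]

open Matrix

/-- The classical identity `h(s) = w(s) w(-1)` in `SL_2`, with `w(s) = x(s) y(-s⁻¹) x(s)` the
monomial matrix with off-diagonal entries `s` and `-s⁻¹`. -/
lemma diagonal_mulSingle_eq {i j : ι} (hij : i ≠ j) {s : ℂ} (hs : s ≠ 0) :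
    diagonal (Pi.mulSingle i s * Pi.mulSingle j s⁻¹) =
      transvection i j s * transvection j i (-s⁻¹) * transvection i j s *
        (transvection i j (-1) * transvection j i 1 * transvection i j (-1)) := by
  have hd : diagonal (Pi.mulSingle i s * Pi.mulSingle j s⁻¹) =
      (1 : Matrix ι ι ℂ) + single i i (s - 1) + single j j (s⁻¹ - 1) := by
    ext a b
    rcases eq_or_ne a b with rfl | hab
    · rcases eq_or_ne a i with rfl | hai
      · simp [hij, hij.symm]
      · rcases eq_or_ne a j with rfl | haj
        · simp [hij, hij.symm]
        · simp [hai, haj, hai.symm, haj.symm]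
    · have h1 : ¬ (i = a ∧ i = b) := fun h => hab (h.1.symm.trans h.2)
      have h2 : ¬ (j = a ∧ j = b) := fun h => hab (h.1.symm.trans h.2)
      simp [hab, h1, h2]
  have hs1 (a b : ι) (c : ℂ) : single a b c = c • single a b (1 : ℂ) := by simp [smul_single]
  rw [hd]
  simp only [transvection, hs1 _ _ s, hs1 _ _ (s - 1), hs1 _ _ (s⁻¹ - 1), hs1 _ _ (-s⁻¹),
    hs1 _ _ (-1), mul_add, add_mul, one_mul, mul_one, smul_mul_assoc, mul_smul_comm,
    single_mul_single_same, single_mul_single_of_ne _ _ _ _ hij,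
    single_mul_single_of_ne _ _ _ _ hij.symm, add_zero, smul_zero]
  match_scalars <;> field_simp <;> ring

/-- The special linear group is generated by transvections. -/
lemma induction_of_det_eq_one (P : Matrix ι ι ℂ → Prop)
    (ht : ∀ (i j : ι) (_ : i ≠ j) (c : ℂ), P (transvection i j c))
    (hone : P 1) (hmul : ∀ A B, P A → P B → P (A * B)) (M : Matrix ι ι ℂ) (hM : M.det = 1) :
    P M := by
  refine diagonal_transvection_induction P M (fun D hD => ?_) (fun t => ht _ _ t.hij t.c) hmul
  rw [hM, det_diagonal] at hD
  rcases isEmpty_or_nonempty ι with hι | ⟨⟨j⟩⟩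
  · convert hone
    exact Subsingleton.elim _ _
  -- The surplus entries at the fixed index `j` multiply to the inverse of the determinant, which is
  -- one.
  have hprod : D = ∏ i, (Pi.mulSingle i (D i) * Pi.mulSingle j (D i)⁻¹) := by
    rw [Finset.prod_mul_distrib, Finset.univ_prod_mulSingle]
    have : ∏ i, (Pi.mulSingle j (D i)⁻¹ : ι → ℂ) = 1 := by
      funext k
      rw [Finset.prod_apply]
      rcases eq_or_ne k j with rfl | hk
      · simp [hD]
      · simp [hk]
    rw [this, mul_one]
  rw [hprod]
  refine Finset.prod_induction (fun i => Pi.mulSingle i (D i) * Pi.mulSingle j (D i)⁻¹)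
    (fun E : ι → ℂ => P (diagonal E)) (fun E E' h h' => ?_) (by simpa using hone) (fun i _ => ?_)
  · have := hmul _ _ h h'
    rwa [diagonal_mul_diagonal] at this
  · have hDi : D i ≠ 0 := fun h => by
      rw [Finset.prod_eq_zero (Finset.mem_univ i) h] at hD
      exact zero_ne_one hD
    rcases eq_or_ne i j with rfl | hij
    · rw [← Pi.mulSingle_mul, mul_inv_cancel₀ hDi]
      simpa using hone
    · rw [diagonal_mulSingle_eq hij hDi]
      exact hmul _ _ (hmul _ _ (hmul _ _ (ht _ _ hij _) (ht _ _ hij.symm _)) (ht _ _ hij _))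
        (hmul _ _ (hmul _ _ (ht _ _ hij _) (ht _ _ hij.symm _)) (ht _ _ hij _))

end Transvections

/-- Invariance under the special linear group follows from invariance under transvections. -/
lemma evalAt_linAct_of_transvection {n : ℕ} {f : PolyFun n}
    (H : ∀ (i j : Fin (n + 1)) (_ : i ≠ j) (c : ℂ) (a : Series n),
      evalAt (linAct (Matrix.transvection i j c) a) f = evalAt a f)
    (g : Matrix.SpecialLinearGroup (Fin (n + 1)) ℂ) (a : Series n) :
    evalAt (linAct g.1 a) f = evalAt a f := by
  refine induction_of_det_eq_one (fun M => ∀ a, evalAt (linAct M a) f = evalAt a f) H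
    (fun a => by rw [linAct_one]) (fun A B hA hB a => ?_) g.1 g.2 a
  rw [linAct_mul, hA, hB]

lemma isPolyCurve_transvection {n : ℕ} (i j : Fin (n + 1)) (a : Series n) :
    IsPolyCurve fun s => linAct (Matrix.transvection i j s) a := fun k l => by
  refine ⟨Polynomial.C (PowerSeries.coeff l (a k)) +
    Polynomial.C (if i = k then PowerSeries.coeff l (a j) else 0) * Polynomial.X, fun s => ?_⟩
  rw [coeff_linAct]
  simp only [Matrix.transvection, Matrix.add_apply, Matrix.one_apply, Matrix.single_apply, add_mul,
    Finset.sum_add_distrib, ite_mul, one_mul, zero_mul, Finset.sum_ite_eq, Finset.mem_univ, if_true,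
    Polynomial.eval_add, Polynomial.eval_mul, Polynomial.eval_C, Polynomial.eval_X]
  split_ifs with h <;> simp [h, mul_comm]

/-! ### A criterion for being a differential invariant -/

/-- The family that joins the reparametrisation by `(u, t * w)` to the one by its leading terms. -/
lemma isPolyCurve_reparam {n : ℕ} (u w : PowerSeries ℂ) (a : Series n) :
    IsPolyCurve fun s =>
      reparam (PowerSeries.rescale s u) (PowerSeries.X * PowerSeries.rescale s w) a := fun i j => by
  refine ⟨∑ k ∈ Finset.HasAntidiagonal.antidiagonal j,
    (Polynomial.X ^ k.1 * Polynomial.C (PowerSeries.coeff k.1 u)) *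
    ∑ d ∈ Finset.range (k.2 + 1), Polynomial.C (PowerSeries.coeff d (a i)) *
      if d ≤ k.2 then (Polynomial.X ^ (k.2 - d) *
        Polynomial.C (PowerSeries.coeff (k.2 - d) (w ^ d))) else 0, fun s => ?_⟩
  rw [coeff_reparam (by simp), Polynomial.eval_finsetSum]
  refine Finset.sum_congr rfl fun k _ => ?_
  rw [Polynomial.eval_mul, Polynomial.eval_finsetSum]
  congr 1
  · simp only [PowerSeries.coeff_rescale, Polynomial.eval_mul, Polynomial.eval_pow,
      Polynomial.eval_X, Polynomial.eval_C]
  · refine Finset.sum_congr rfl fun d _ => ?_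
    rw [mul_pow, ← map_pow, PowerSeries.coeff_X_pow_mul', PowerSeries.coeff_rescale]
    split_ifs <;> simp only [Polynomial.eval_mul, Polynomial.eval_pow, Polynomial.eval_X,
      Polynomial.eval_C, Polynomial.eval_zero]

lemma subst_X_mul_C (c : ℂ) (f : PowerSeries ℂ) :
    PowerSeries.subst (PowerSeries.X * PowerSeries.C c) f = PowerSeries.rescale c f := by
  rw [PowerSeries.rescale_eq_subst, PowerSeries.smul_eq_C_mul, mul_comm]

lemma reparam_C {n : ℕ} (c d : ℂ) (a : Series n) :
    reparam (PowerSeries.C c) (PowerSeries.X * PowerSeries.C d) a =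
      torus (fun _ _ => 1) c (torus (fun _ j => j) d a) := by
  ext i j
  simp [reparam, subst_X_mul_C, PowerSeries.coeff_rescale]

lemma torus_one {n : ℕ} (w : Fin (n + 1) → ℕ → ℕ) (a : Series n) : torus w 1 a = a := by
  ext i j
  simp

lemma isUnitSeries_C {c : ℂ} (hc : c ≠ 0) : IsUnitSeries (PowerSeries.C c) := by
  simpa [IsUnitSeries] using hc

lemma coeff_one_X_mul (w : PowerSeries ℂ) :
    PowerSeries.coeff 1 (PowerSeries.X * w) = PowerSeries.coeff 0 w :=
  PowerSeries.coeff_succ_X_mul 0 w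

lemma isParamChange_X_mul {w : PowerSeries ℂ} (hw : PowerSeries.coeff 0 w ≠ 0) :
    IsParamChange (PowerSeries.X * w) := by
  refine ⟨by simp, ?_⟩
  rwa [coeff_one_X_mul]

/-- A polynomial function without zeros on a dense stable set is a differential invariant. -/
theorem exists_mem_invariants_of_stable {n : ℕ} {f h : PolyFun n} (hh : h ≠ 0) (Ω : Set (Series n))
    (hΩ : ∀ a, evalAt a h ≠ 0 → a ∈ Ω)
    (hSL : ∀ (g : Matrix.SpecialLinearGroup (Fin (n + 1)) ℂ), ∀ a ∈ Ω, linAct g.1 a ∈ Ω)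
    (hG : ∀ u v, IsUnitSeries u → IsParamChange v → ∀ a ∈ Ω, reparam u v a ∈ Ω)
    (hf : ∀ a ∈ Ω, evalAt a f ≠ 0) : ∃ δ ϖ : ℕ, f ∈ invariants n δ ϖ := by
  have hX : (PowerSeries.X : PowerSeries ℂ) = PowerSeries.X * PowerSeries.C 1 := by simp
  obtain ⟨δ, hδ⟩ := exists_torus_weight (fun _ _ => 1) (f := f) hh (fun a ha s hs => by
    have : torus (fun _ _ => 1) s a = reparam (PowerSeries.C s) PowerSeries.X a := by
      conv_rhs => rw [hX]
      rw [reparam_C, torus_one]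
    rw [this]
    refine hf _ (hG _ _ (isUnitSeries_C hs) ?_ a (hΩ a ha))
    rw [hX]
    exact isParamChange_X_mul (by simp))
  obtain ⟨ϖ, hϖ⟩ := exists_torus_weight (fun _ j => j) (f := f) hh (fun a ha s hs => by
    have : torus (fun _ j => j) s a =
        reparam (PowerSeries.C 1) (PowerSeries.X * PowerSeries.C s) a := by
      rw [reparam_C, torus_one]
    rw [this]
    exact hf _ (hG _ _ (isUnitSeries_C one_ne_zero) (isParamChange_X_mul (by simpa using hs))
      a (hΩ a ha)))
  refine ⟨δ, ϖ, fun a u v _ hu hv => ?_, fun g a _ => ?_⟩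
  · refine (IsPolyMap.reparam hv.1 u).evalAt_eq IsPolyMap.id hh (fun b hb => ?_) a
    obtain ⟨w, rfl⟩ := PowerSeries.X_dvd_iff.2 (by simpa using hv.1)
    have hw := coeff_one_X_mul w
    have hw0 : PowerSeries.coeff 0 w ≠ 0 := by
      rw [← hw]; exact hv.2
    -- For every `s`, including `0`, the rescaled pair is still in the group because its leading
    -- coefficients do not change. The curve thus stays in `Ω` and `f` is constant on it; at `s = 0`
    -- only the torus element remains, which acts by the weights `δ` and `ϖ`.
    have key := (isPolyCurve_reparam u w b).evalAt_eq (f := f) (fun s => hf _ (hG _ _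
      (by simpa [IsUnitSeries, PowerSeries.coeff_rescale] using hu)
      (isParamChange_X_mul (by simpa [PowerSeries.coeff_rescale] using hw0)) b (hΩ b hb))) 1 0
    simp only [PowerSeries.rescale_one, RingHom.id_apply, PowerSeries.rescale_zero,
      RingHom.comp_apply, reparam_C, hδ, hϖ] at key
    rw [key, hw]
    simp [mul_assoc]
  · refine evalAt_linAct_of_transvection (fun i j hij c a => ?_) g a
    have := (IsPolyMap.linAct (Matrix.transvection i j c)).evalAt_eq IsPolyMap.id hh
      (f := f) (g := f) (c := 1) (fun b hb => ?_) a
    · rwa [one_mul] at this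
    · have := (isPolyCurve_transvection i j b).evalAt_eq (f := f) (fun s =>
        hf _ (hSL ⟨_, Matrix.det_transvection_of_ne i j hij s⟩ b (hΩ b hb))) c 0
      rw [this, Matrix.transvection_zero, linAct_one, one_mul]

/-- A divisor of a non-zero differential invariant is a differential invariant. -/
theorem exists_mem_invariants_of_dvd {n : ℕ} (hn : 0 < n) {f q : PolyFun n} {δ ϖ : ℤ}
    (hf : f ∈ invariants n δ ϖ) (hf0 : f ≠ 0) (hq : q ∣ f) :
    ∃ δ' ϖ' : ℕ, q ∈ invariants n δ' ϖ' := by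
  refine exists_mem_invariants_of_stable hf0 {a | evalAt a f ≠ 0} (fun a ha => ha)
    (fun g a ha => ?_) (fun u v hu hv a ha => ?_) (fun a ha h => ?_)
  · rw [Set.mem_ofPred_eq, evalAt_linAct_of_mem hn hf]
    exact ha
  · rw [Set.mem_ofPred_eq, evalAt_reparam_of_mem hn hf a hu hv]
    exact mul_ne_zero (mul_ne_zero (zpow_ne_zero _ hu) (zpow_ne_zero _ hv.2)) ha
  · obtain ⟨r, rfl⟩ := hq
    exact ha (by rw [evalAt_mul, h, zero_mul])

/-- A scalar multiple of a series. -/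
lemma evalAt_smul_of_mem {n : ℕ} (hn : 0 < n) {δ ϖ : ℤ} {f : PolyFun n}
    (hf : f ∈ invariants n δ ϖ) (a : Series n) {c : ℂ} (hc : c ≠ 0) :
    evalAt (c • a) f = c ^ δ * evalAt a f := by
  have hX : (PowerSeries.X : PowerSeries ℂ) = PowerSeries.X * PowerSeries.C 1 := by simp
  have h1 : c • a = reparam (PowerSeries.C c) (PowerSeries.X * PowerSeries.C 1) a := by
    rw [reparam_C, torus_one]
    ext i j
    simp
  rw [h1, evalAt_reparam_of_mem hn hf a (isUnitSeries_C hc) (isParamChange_X_mul (by simp))]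
  simp

lemma linAct_smul {n : ℕ} (c : ℂ) (g : Matrix (Fin (n + 1)) (Fin (n + 1)) ℂ) (a : Series n) :
    linAct (c • g) a = c • linAct g a := by
  ext i j
  simp [coeff_linAct, Finset.mul_sum, mul_assoc]

/-- Extends the transformation law to the general linear group: up to the scalar `c` the matrix is
unimodular, and scalars act through the degree. Any root of the determinant will do. -/
lemma evalAt_linAct_of_pow_eq_det {n : ℕ} (hn : 0 < n) {δ ϖ : ℤ} {f : PolyFun n}
    (hf : f ∈ invariants n δ ϖ) (a : Series n) (g : Matrix (Fin (n + 1)) (Fin (n + 1)) ℂ) {c : ℂ}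
    (hc : c ≠ 0) (hcg : c ^ (n + 1) = g.det) : evalAt (linAct g a) f = c ^ δ * evalAt a f := by
  have hdet : (c⁻¹ • g).det = 1 := by
    rw [Matrix.det_smul, Fintype.card_fin, inv_pow, hcg]
    exact inv_mul_cancel₀ (hcg ▸ pow_ne_zero _ hc)
  have h1 : g = c • (c⁻¹ • g) := by rw [smul_smul, mul_inv_cancel₀ hc, one_smul]
  rw [h1, linAct_smul, evalAt_smul_of_mem hn hf _ hc]
  congr 1
  exact evalAt_linAct_of_mem hn hf a ⟨_, hdet⟩

/-! ### Osculants: non-vanishing, invariance and bidegree -/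

section Osculation

/-- The exponents of the monomials of degree `m` in `n + 1` variables. -/
abbrev monomialExponents (n m : ℕ) : Finset (Fin (n + 1) →₀ ℕ) :=
  (Finset.univ : Finset (Fin (n + 1))).finsuppAntidiag m

/-- An enumeration of the monomials of degree `m`. -/
def monomialEnum (n m : ℕ) : Fin (monomialExponents n m).card ≃ monomialExponents n m :=
  (Finset.equivFin _).symm

lemma sum_monomialEnum {n m : ℕ} (k : Fin (monomialExponents n m).card) :
    ∑ i, (monomialEnum n m k).1 i = m :=
  (Finset.mem_finsuppAntidiag.1 (monomialEnum n m k).2).1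

/-- The matrix of the coefficients of the monomials of degree `m` in the coordinates of a series. -/
def osculationMatrix {R : Type*} [CommRing R] {n : ℕ} (m : ℕ) (a : Fin (n + 1) → PowerSeries R) :
    Matrix (Fin (monomialExponents n m).card) (Fin (monomialExponents n m).card) R :=
  Matrix.of fun k j => PowerSeries.coeff j (∏ i, a i ^ (monomialEnum n m k).1 i)

/-- The Wronskian of the monomials of degree `m` in the coordinates. It vanishes on the arcs which
osculate a hypersurface of degree `m` to a higher order than expected. -/
def osculant (n m : ℕ) : PolyFun n :=
  (osculationMatrix m fun i => PowerSeries.mk fun j => MvPolynomial.X (i, j)).det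

lemma evalAt_osculant {n : ℕ} (m : ℕ) (a : Series n) :
    evalAt a (osculant n m) = (osculationMatrix m a).det := by
  rw [evalAt, osculant, RingHom.map_det]
  congr 1
  ext k j
  simp only [osculationMatrix, RingHom.mapMatrix_apply, Matrix.map_apply, Matrix.of_apply]
  rw [← PowerSeries.coeff_map, map_prod]
  congr 1
  refine Finset.prod_congr rfl fun i _ => ?_
  rw [map_pow]
  congr 1
  ext l
  simp [coeffVec]

lemma aeval_monomial_sum {n m : ℕ} (a : Series n) (y : Fin (monomialExponents n m).card → ℂ) :
    MvPolynomial.aeval a (∑ k, MvPolynomial.monomial (monomialEnum n m k).1 (y k)) =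
      ∑ k, y k • ∏ i, a i ^ (monomialEnum n m k).1 i := by
  rw [map_sum]
  refine Finset.sum_congr rfl fun k _ => ?_
  rw [MvPolynomial.aeval_monomial, Algebra.smul_def, Finsupp.prod_fintype]
  simp

lemma coeff_monomial_sum {n m : ℕ} (y : Fin (monomialExponents n m).card → ℂ)
    (k : Fin (monomialExponents n m).card) :
    MvPolynomial.coeff (monomialEnum n m k).1
      (∑ k, MvPolynomial.monomial (monomialEnum n m k).1 (y k)) = y k := by
  rw [MvPolynomial.coeff_sum]
  simp only [MvPolynomial.coeff_monomial, Subtype.val_inj, EmbeddingLike.apply_eq_iff_eq]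
  simp

lemma isHomogeneous_monomial_sum {n m : ℕ} (y : Fin (monomialExponents n m).card → ℂ) :
    (∑ k, MvPolynomial.monomial (monomialEnum n m k).1 (y k)).IsHomogeneous m :=
  MvPolynomial.IsHomogeneous.sum _ _ _ fun k _ =>
    MvPolynomial.isHomogeneous_monomial _ (by rw [Finsupp.degree_eq_sum, sum_monomialEnum])

lemma eq_monomial_sum {n m : ℕ} {F : MvPolynomial (Fin (n + 1)) ℂ} (hF : F.IsHomogeneous m) :
    F = ∑ k, MvPolynomial.monomial (monomialEnum n m k).1
      (MvPolynomial.coeff (monomialEnum n m k).1 F) := by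
  ext α
  by_cases hα : α.degree = m
  · obtain ⟨k, hk⟩ := (monomialEnum n m).surjective ⟨α, Finset.mem_finsuppAntidiag.2
      ⟨by rw [← Finsupp.degree_eq_sum, hα], Finset.subset_univ _⟩⟩
    have : α = (monomialEnum n m k).1 := by rw [hk]
    rw [this, coeff_monomial_sum]
  · rw [hF.coeff_eq_zero hα, (isHomogeneous_monomial_sum _).coeff_eq_zero hα]

/-- The osculant does not vanish if and only if no form of degree `m` osculates too much. -/
lemma evalAt_osculant_ne_zero_iff {n m : ℕ} (a : Series n) : evalAt a (osculant n m) ≠ 0 ↔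
    ∀ F : MvPolynomial (Fin (n + 1)) ℂ, F.IsHomogeneous m →
      PowerSeries.X ^ (monomialExponents n m).card ∣ MvPolynomial.aeval a F → F = 0 := by
  -- A vector in the left kernel of the matrix is the coefficient vector of a form whose contact
  -- with the arc has order at least the number of monomials.
  have hrow (y : Fin (monomialExponents n m).card → ℂ) :
      Matrix.vecMul y (osculationMatrix m a) = 0 ↔
        PowerSeries.X ^ (monomialExponents n m).card ∣ MvPolynomial.aeval a
          (∑ k, MvPolynomial.monomial (monomialEnum n m k).1 (y k)) := by
    rw [aeval_monomial_sum, PowerSeries.X_pow_dvd_iff]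
    constructor
    · intro h j hj
      have := congrFun h ⟨j, hj⟩
      simpa [Matrix.vecMul, dotProduct, osculationMatrix] using this
    · intro h
      funext j
      have := h j j.2
      simpa [Matrix.vecMul, dotProduct, osculationMatrix] using this
  rw [evalAt_osculant, Ne, ← Matrix.exists_vecMul_eq_zero_iff]
  push Not
  constructor
  · intro H F hF hdvd
    rw [eq_monomial_sum hF] at hdvd
    by_contra hF0
    refine H _ (fun h0 => hF0 ?_) ((hrow _).2 hdvd)
    rw [eq_monomial_sum hF]
    refine Finset.sum_eq_zero fun k _ => ?_
    have := congrFun h0 k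
    simp only [Pi.zero_apply] at this
    rw [this, map_zero]
  · intro H y hy h0
    refine hy (funext fun k => ?_)
    have := H _ (isHomogeneous_monomial_sum y) ((hrow y).1 h0)
    rw [← coeff_monomial_sum y k, this]
    simp

lemma aeval_mul_of_isHomogeneous {n m : ℕ} {F : MvPolynomial (Fin (n + 1)) ℂ}
    (hF : F.IsHomogeneous m) (u : PowerSeries ℂ) (a : Series n) :
    MvPolynomial.aeval (fun i => u * a i) F = u ^ m * MvPolynomial.aeval a F := by
  rw [eq_monomial_sum hF]
  have := aeval_monomial_sum (m := m) (fun i => u * a i)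
    (fun k => MvPolynomial.coeff (monomialEnum n m k).1 F)
  rw [this, aeval_monomial_sum, Finset.mul_sum]
  refine Finset.sum_congr rfl fun k _ => ?_
  simp_rw [mul_pow]
  rw [Finset.prod_mul_distrib, Finset.prod_pow_eq_pow_sum, sum_monomialEnum, mul_smul_comm]

/-- The order of contact is not lowered by undoing a change of parameter: the substitution is
triangular on coefficients, with the powers of `v'(0)` on the diagonal. -/
lemma X_pow_dvd_of_dvd_subst {v : PowerSeries ℂ} (hv : IsParamChange v) {K : ℕ}
    {f : PowerSeries ℂ} (h : PowerSeries.X ^ K ∣ PowerSeries.subst v f) :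
    PowerSeries.X ^ K ∣ f := by
  rw [PowerSeries.X_pow_dvd_iff] at h ⊢
  intro j
  induction j using Nat.strong_induction_on with
  | _ j ih =>
    intro hj
    have h1 := h j hj
    rw [coeff_subst_eq_sum hv.1, Finset.sum_range_succ, Finset.sum_eq_zero, zero_add] at h1
    · refine (mul_eq_zero.1 h1).resolve_right ?_
      obtain ⟨w, rfl⟩ := PowerSeries.X_dvd_iff.2 (by simpa using hv.1)
      have h2 := hv.2
      rw [coeff_one_X_mul] at h2
      rw [mul_pow, PowerSeries.coeff_X_pow_mul', if_pos le_rfl, Nat.sub_self,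
        PowerSeries.coeff_zero_eq_constantCoeff, map_pow]
      exact pow_ne_zero _ (by simpa using h2)
    · intro d hd
      rw [ih d (Finset.mem_range.1 hd) (by have := Finset.mem_range.1 hd; omega), zero_mul]

lemma aeval_reparam {n m : ℕ} {F : MvPolynomial (Fin (n + 1)) ℂ} (hF : F.IsHomogeneous m)
    (u : PowerSeries ℂ) {v : PowerSeries ℂ} (hv : PowerSeries.coeff 0 v = 0) (a : Series n) :
    MvPolynomial.aeval (reparam u v a) F =
      u ^ m * PowerSeries.subst v (MvPolynomial.aeval a F) := by
  have h1 : reparam u v a = fun i => u * PowerSeries.subst v (a i) := rfl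
  rw [h1, aeval_mul_of_isHomogeneous hF, ← PowerSeries.coe_substAlgHom (hasSubst_of_coeff_zero hv)]
  congr 1
  have : ((PowerSeries.substAlgHom (R := ℂ) (hasSubst_of_coeff_zero hv)).comp
      (MvPolynomial.aeval a)) = MvPolynomial.aeval
        fun i => PowerSeries.substAlgHom (R := ℂ) (hasSubst_of_coeff_zero hv) (a i) := by
    ext1 i
    simp
  rw [← this]
  rfl

/-- A linear substitution of variables. -/
def linSubst {n : ℕ} (g : Matrix (Fin (n + 1)) (Fin (n + 1)) ℂ) :
    MvPolynomial (Fin (n + 1)) ℂ →ₐ[ℂ] MvPolynomial (Fin (n + 1)) ℂ :=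
  MvPolynomial.aeval fun i => ∑ k, g i k • MvPolynomial.X k

lemma linSubst_mul {n : ℕ} (g g' : Matrix (Fin (n + 1)) (Fin (n + 1)) ℂ)
    (F : MvPolynomial (Fin (n + 1)) ℂ) : linSubst (g * g') F = linSubst g' (linSubst g F) := by
  have : linSubst (g * g') = (linSubst g').comp (linSubst g) := by
    ext1 i
    simp only [linSubst, AlgHom.comp_apply, MvPolynomial.aeval_X, map_sum, map_smul,
      Matrix.mul_apply, Finset.sum_smul, Finset.smul_sum, mul_smul]
    exact Finset.sum_comm
  rw [this]
  rfl

lemma linSubst_one {n : ℕ} (F : MvPolynomial (Fin (n + 1)) ℂ) : linSubst 1 F = F := by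
  have : linSubst (n := n) 1 = AlgHom.id ℂ _ := by
    ext1 i
    simp [linSubst, Matrix.one_apply]
  rw [this]
  rfl

lemma aeval_linAct {n : ℕ} (g : Matrix (Fin (n + 1)) (Fin (n + 1)) ℂ) (a : Series n)
    (F : MvPolynomial (Fin (n + 1)) ℂ) :
    MvPolynomial.aeval (linAct g a) F = MvPolynomial.aeval a (linSubst g F) := by
  have : MvPolynomial.aeval (R := ℂ) (linAct g a) = (MvPolynomial.aeval a).comp (linSubst g) := by
    ext1 i
    simp [linSubst, linAct]
  rw [this]
  rfl

lemma isHomogeneous_linSubst {n m : ℕ} (g : Matrix (Fin (n + 1)) (Fin (n + 1)) ℂ)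
    {F : MvPolynomial (Fin (n + 1)) ℂ} (hF : F.IsHomogeneous m) :
    (linSubst g F).IsHomogeneous m := by
  have := hF.aeval (n := 1) (fun i => ∑ k, g i k • (MvPolynomial.X k : MvPolynomial _ ℂ))
    (fun i => MvPolynomial.IsHomogeneous.sum _ _ _ fun k _ => by
      rw [MvPolynomial.smul_eq_C_mul]
      exact (MvPolynomial.isHomogeneous_X _ _).C_mul _)
  rwa [one_mul] at this

lemma evalAt_linAct_osculant_ne_zero {n m : ℕ} {a : Series n}
    (ha : evalAt a (osculant n m) ≠ 0) (g : Matrix.SpecialLinearGroup (Fin (n + 1)) ℂ) :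
    evalAt (linAct g.1 a) (osculant n m) ≠ 0 := by
  rw [evalAt_osculant_ne_zero_iff] at ha ⊢
  intro F hF hdvd
  rw [aeval_linAct] at hdvd
  have h0 := ha _ (isHomogeneous_linSubst _ hF) hdvd
  have h1 : linSubst (g.1 * g⁻¹.1) F = F := by
    rw [← Matrix.SpecialLinearGroup.coe_mul, mul_inv_cancel, Matrix.SpecialLinearGroup.coe_one,
      linSubst_one]
  rw [← h1, linSubst_mul, h0, map_zero]

lemma evalAt_reparam_osculant_ne_zero {n m : ℕ} {a : Series n}
    (ha : evalAt a (osculant n m) ≠ 0) {u v : PowerSeries ℂ} (hu : IsUnitSeries u)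
    (hv : IsParamChange v) : evalAt (reparam u v a) (osculant n m) ≠ 0 := by
  rw [evalAt_osculant_ne_zero_iff] at ha ⊢
  intro F hF hdvd
  rw [aeval_reparam hF u hv.1] at hdvd
  refine ha F hF (X_pow_dvd_of_dvd_subst hv ?_)
  have hu' : IsUnit u := PowerSeries.isUnit_iff_constantCoeff.2
    (by simpa [IsUnitSeries, isUnit_iff_ne_zero] using hu)
  exact ((hu'.pow m).dvd_mul_left).1 hdvd

/-- On the arc with coordinates `(1 + t) ^ ((m + 1) ^ i)`, monomials become distinct powers of `1 +
t`. The matrix has entries `(E k).choose j`; multiplying column `j` by `j!` turns them into falling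
factorials, whose determinant is that of Vandermonde. -/
lemma exists_osculant_ne_zero (n m : ℕ) : osculant n m ≠ 0 := by
  intro h0
  have hlt (k : Fin (monomialExponents n m).card) (i : Fin (n + 1)) :
      (monomialEnum n m k).1 i < m + 1 := by
    have := Finset.single_le_sum (f := fun i => (monomialEnum n m k).1 i)
      (fun _ _ => Nat.zero_le _) (Finset.mem_univ i)
    rw [sum_monomialEnum] at this
    omega
  set E : Fin (monomialExponents n m).card → ℕ :=
    fun k => ∑ i : Fin (n + 1), (monomialEnum n m k).1 i * (m + 1) ^ (i : ℕ) with hE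
  -- The exponents are at most `m`, so they are the digits of `E k` in base `m + 1`.
  have hEinj : Function.Injective E := by
    intro k l hkl
    have h1 : finFunctionFinEquiv (fun i => (⟨_, hlt k i⟩ : Fin (m + 1))) =
        finFunctionFinEquiv (fun i => (⟨_, hlt l i⟩ : Fin (m + 1))) :=
      Fin.ext (by simpa [finFunctionFinEquiv_apply] using hkl)
    have h2 := finFunctionFinEquiv.injective h1
    apply (monomialEnum n m).injective
    ext i
    exact congrArg Fin.val (congrFun h2 i)
  set a : Series n := fun i => (((1 + Polynomial.X) ^ (m + 1) ^ (i : ℕ) : Polynomial ℂ) :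
    PowerSeries ℂ) with ha
  have hentry (k j) : osculationMatrix m a k j = ((E k).choose j : ℂ) := by
    simp only [osculationMatrix, Matrix.of_apply, ha]
    have : ∏ i : Fin (n + 1), (((1 + Polynomial.X) ^ (m + 1) ^ (i : ℕ) : Polynomial ℂ) :
        PowerSeries ℂ) ^ (monomialEnum n m k).1 i =
        (((1 + Polynomial.X) ^ E k : Polynomial ℂ) : PowerSeries ℂ) := by
      rw [hE]
      simp only [← Finset.prod_pow_eq_pow_sum, mul_comm _ ((m + 1) ^ _), pow_mul]
      rw [← Polynomial.coeToPowerSeries.ringHom_apply, map_prod]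
      simp
    rw [this, Polynomial.coeff_coe, Polynomial.coeff_one_add_X_pow]
  have hdet := Matrix.det_eval_matrixOfPolynomials_eq_det_vandermonde (fun k => (E k : ℂ))
    (fun j : Fin (monomialExponents n m).card => descPochhammer ℂ j)
    (fun j => descPochhammer_natDegree ℂ j) (fun j => monic_descPochhammer ℂ j)
  have hmat : (Matrix.of fun k j : Fin (monomialExponents n m).card =>
      Polynomial.eval (E k : ℂ) (descPochhammer ℂ j)) =
      Matrix.of fun k j : Fin (monomialExponents n m).card =>
        ((j : ℕ).factorial : ℂ) * osculationMatrix m a k j := by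
    ext k j
    rw [Matrix.of_apply, Matrix.of_apply, hentry, descPochhammer_eval_eq_descFactorial,
      Nat.descFactorial_eq_factorial_mul_choose, Nat.cast_mul]
  rw [hmat, Matrix.det_mul_row, ← evalAt_osculant, h0, evalAt_zero, mul_zero] at hdet
  exact Matrix.det_vandermonde_ne_zero_iff.2 (Nat.cast_injective.comp hEinj) hdet

lemma two_pow_injective : Function.Injective fun k : ℕ => (2 : ℂ) ^ k := by
  intro k l h
  have : ((2 ^ k : ℕ) : ℂ) = ((2 ^ l : ℕ) : ℂ) := by push_cast; exact h
  exact Nat.pow_right_injective le_rfl (Nat.cast_injective this)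

/-- The osculants are differential invariants. -/
theorem osculant_mem {n : ℕ} (hn : 0 < n) (m : ℕ) :
    osculant n m ∈ invariants n ((m * (monomialExponents n m).card : ℕ) : ℤ)
      ((monomialExponents n m).card.choose 2 : ℕ) := by
  obtain ⟨δ, ϖ, h⟩ := exists_mem_invariants_of_stable (exists_osculant_ne_zero n m)
    {a | evalAt a (osculant n m) ≠ 0} (fun a ha => ha)
    (fun g a ha => evalAt_linAct_osculant_ne_zero ha g)
    (fun u v hu hv a ha => evalAt_reparam_osculant_ne_zero ha hu hv) (fun a ha => ha)
  obtain ⟨a, ha⟩ := exists_evalAt_ne_zero (exists_osculant_ne_zero n m)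
  have hδ : δ = m * (monomialExponents n m).card := by
    have h1 := evalAt_smul_of_mem hn h a (two_ne_zero (α := ℂ))
    have h2 : osculationMatrix m ((2 : ℂ) • a) = ((2 : ℂ) ^ m) • osculationMatrix m a := by
      ext k j
      simp only [osculationMatrix, Matrix.of_apply, Matrix.smul_apply, Pi.smul_apply, smul_pow]
      rw [Finset.prod_smul, Finset.prod_pow_eq_pow_sum, sum_monomialEnum]
      simp
    rw [evalAt_osculant, h2, Matrix.det_smul, Fintype.card_fin, ← pow_mul, ← evalAt_osculant,
      zpow_natCast] at h1
    exact (two_pow_injective (mul_right_cancel₀ ha h1)).symm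
  have hϖ : ϖ = (monomialExponents n m).card.choose 2 := by
    have h1 := evalAt_reparam_of_mem hn h a (isUnitSeries_C one_ne_zero)
      (isParamChange_X_mul (w := PowerSeries.C 2) (by simp))
    have h2 : osculationMatrix m (reparam (PowerSeries.C 1) (PowerSeries.X * PowerSeries.C 2) a) =
        Matrix.of fun k j : Fin (monomialExponents n m).card =>
          (2 : ℂ) ^ (j : ℕ) * osculationMatrix m a k j := by
      ext k j
      simp only [osculationMatrix, Matrix.of_apply, reparam, subst_X_mul_C, map_one, one_mul]
      rw [← PowerSeries.coeff_rescale]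
      simp
    rw [evalAt_osculant, h2, Matrix.det_mul_row, ← evalAt_osculant, Finset.prod_pow_eq_pow_sum,
      Fin.sum_univ_eq_sum_range (fun j => j), Finset.sum_range_id, ← Nat.choose_two_right] at h1
    have h3 : PowerSeries.coeff 1 (PowerSeries.X * PowerSeries.C (2 : ℂ)) = 2 := by
      rw [coeff_one_X_mul]
      simp
    rw [h3, zpow_natCast, zpow_natCast] at h1
    simp only [PowerSeries.coeff_zero_eq_constantCoeff, PowerSeries.constantCoeff_C, one_pow,
      one_mul] at h1
    exact (two_pow_injective (mul_right_cancel₀ ha h1)).symm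
  rwa [hδ, hϖ] at h

end Osculation

/-! ### The invariant ring and restrictions on bidegrees -/

lemma mem_invariantRing_iff {n : ℕ} {f : PolyFun n} :
    f ∈ invariantRing n ↔ f ∈ ⨆ e : ℤ × ℤ, invariants n e.1 e.2 := Iff.rfl

lemma mem_invariantRing_of_mem {n : ℕ} {δ ϖ : ℤ} {f : PolyFun n} (hf : f ∈ invariants n δ ϖ) :
    f ∈ invariantRing n :=
  mem_invariantRing_iff.2 (Submodule.mem_iSup_of_mem
    (p := fun e : ℤ × ℤ => invariants n e.1 e.2) (δ, ϖ) hf)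

lemma evalAt_linAct_of_mem_invariantRing {n : ℕ} (hn : 0 < n) {f : PolyFun n}
    (hf : f ∈ invariantRing n) (g : Matrix.SpecialLinearGroup (Fin (n + 1)) ℂ) (a : Series n) :
    evalAt (linAct g.1 a) f = evalAt a f := by
  rw [mem_invariantRing_iff] at hf
  induction hf using Submodule.iSup_induction' with
  | mem e x hx => exact evalAt_linAct_of_mem hn hx a g
  | zero => simp
  | add x y _ _ hx hy => simp [hx, hy]

section Bidegree

variable {n : ℕ} {f : PolyFun n} {δ ϖ δ' ϖ' : ℤ}

lemma two_zpow_injective : Function.Injective fun k : ℤ => (2 : ℂ) ^ k := by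
  intro k l h
  have : ((2 ^ k : ℝ) : ℂ) = ((2 ^ l : ℝ) : ℂ) := by push_cast; exact h
  exact zpow_right_injective₀ (by norm_num) (by norm_num) (Complex.ofReal_injective this)

lemma bidegree_unique (hn : 0 < n) (hf0 : f ≠ 0) (hf : f ∈ invariants n δ ϖ)
    (hf' : f ∈ invariants n δ' ϖ') : δ = δ' ∧ ϖ = ϖ' := by
  obtain ⟨a, ha⟩ := exists_evalAt_ne_zero hf0
  constructor
  · have h := evalAt_smul_of_mem hn hf a (two_ne_zero (α := ℂ))
    rw [evalAt_smul_of_mem hn hf' a two_ne_zero] at h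
    exact (two_zpow_injective (mul_right_cancel₀ ha h)).symm
  · have h2 : PowerSeries.coeff 0 (PowerSeries.C (2 : ℂ)) ≠ 0 := by simp
    have h := evalAt_reparam_of_mem hn hf a (isUnitSeries_C one_ne_zero) (isParamChange_X_mul h2)
    rw [evalAt_reparam_of_mem hn hf' a (isUnitSeries_C one_ne_zero) (isParamChange_X_mul h2),
      coeff_one_X_mul] at h
    simp only [PowerSeries.coeff_zero_eq_constantCoeff, PowerSeries.constantCoeff_C, one_zpow,
      one_mul] at h
    exact (two_zpow_injective (mul_right_cancel₀ ha h)).symm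

/-- Multiplication by a primitive root of unity of order `n + 1` has determinant one, so it must act
trivially through the degree. -/
lemma succ_dvd_degree (hn : 0 < n) (hf0 : f ≠ 0) (hf : f ∈ invariants n δ ϖ) :
    ((n + 1 : ℕ) : ℤ) ∣ δ := by
  obtain ⟨a, ha⟩ := exists_evalAt_ne_zero hf0
  have hζ := Complex.isPrimitiveRoot_exp (n + 1) n.succ_ne_zero
  rw [← hζ.zpow_eq_one_iff_dvd]
  have h := evalAt_linAct_of_pow_eq_det hn hf a 1 (hζ.ne_zero n.succ_ne_zero)
    (by rw [hζ.pow_eq_one, Matrix.det_one])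
  rw [linAct_one] at h
  exact mul_right_cancel₀ ha (by rw [← h, one_mul])

/-- In degree zero the function is constant on each line through the origin, away from the origin
and hence also at it. -/
lemma eq_C_of_mem_invariants_zero (hn : 0 < n) (hf : f ∈ invariants n 0 ϖ) :
    f = MvPolynomial.C (evalAt 0 f) := by
  refine eq_of_evalAt fun a => ?_
  rw [evalAt_C]
  have hcurve : IsPolyCurve fun s => s • a := fun i j =>
    ⟨Polynomial.C (PowerSeries.coeff j (a i)) * Polynomial.X, fun s => by
      simp only [Polynomial.eval_mul, Polynomial.eval_C, Polynomial.eval_X]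
      exact mul_comm _ _⟩
  obtain ⟨p, hp⟩ := hcurve.exists_polynomial f
  have h1 : p = Polynomial.C (evalAt a f) := by
    refine Polynomial.eq_of_infinite_eval_eq _ _ (Set.Infinite.mono (s := {0}ᶜ) ?_ ?_)
    · intro s hs
      simp only [Set.mem_ofPred_eq, Polynomial.eval_C]
      rw [← hp, evalAt_smul_of_mem hn hf a hs, zpow_zero, one_mul]
    · exact (Set.finite_singleton _).infinite_compl
  have := hp 0
  rw [h1, Polynomial.eval_C, zero_smul] at this
  exact this.symm

end Bidegree

/-! ### Pullback of invariants under projection from the initial point -/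

/-- Drop the first coordinate and divide the positive part by `t`. -/
def tailShift {n : ℕ} (a : Series (n + 1)) : Series n :=
  fun i => PowerSeries.mk fun j => PowerSeries.coeff (j + 1) (a i.succ)

@[simp] lemma coeff_tailShift {n : ℕ} (a : Series (n + 1)) (i : Fin (n + 1)) (j : ℕ) :
    PowerSeries.coeff j (tailShift a i) = PowerSeries.coeff (j + 1) (a i.succ) := by
  simp [tailShift]

lemma tailShift_linAct {n : ℕ} (N : Matrix (Fin (n + 2)) (Fin (n + 2)) ℂ)
    (hN : ∀ i : Fin (n + 1), N i.succ 0 = 0) (b : Series (n + 1)) :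
    tailShift (linAct N b) = linAct (N.submatrix Fin.succ Fin.succ) (tailShift b) := by
  ext i j
  rw [coeff_tailShift, coeff_linAct, coeff_linAct, Fin.sum_univ_succ, hN]
  simp

lemma det_eq_mul_det_submatrix {n : ℕ} (N : Matrix (Fin (n + 2)) (Fin (n + 2)) ℂ)
    (hN : ∀ i : Fin (n + 1), N i.succ 0 = 0) :
    N.det = N 0 0 * (N.submatrix Fin.succ Fin.succ).det := by
  rw [Matrix.det_succ_column_zero, Fin.sum_univ_succ, Finset.sum_eq_zero]
  · simp
  · intro i _
    rw [hN]
    simp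

/-- Vectors that are mapped to the first basis vector. -/
abbrev SendsToFirst {n : ℕ} (M : Matrix (Fin (n + 2)) (Fin (n + 2)) ℂ) (a : Series (n + 1)) :
    Prop :=
  Matrix.mulVec M (coeffVec 0 a) = Pi.single 0 1

lemma coeffVec_linAct {n : ℕ} (g : Matrix (Fin (n + 1)) (Fin (n + 1)) ℂ) (j : ℕ) (a : Series n) :
    coeffVec j (linAct g a) = Matrix.mulVec g (coeffVec j a) := by
  funext i
  simp [coeffVec, coeff_linAct, Matrix.mulVec, dotProduct]

lemma col_zero_of_mulVec {n : ℕ} {N : Matrix (Fin (n + 2)) (Fin (n + 2)) ℂ} {c : ℂ}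
    (h : Matrix.mulVec N (Pi.single 0 1) = Pi.single 0 c) :
    N 0 0 = c ∧ ∀ i : Fin (n + 1), N i.succ 0 = 0 := by
  rw [Matrix.mulVec_single_one] at h
  exact ⟨by simpa using congrFun h 0, fun i => by simpa using congrFun h i.succ⟩

/-- The pullback is well defined: `M' * M⁻¹` fixes the first basis vector, so its lower block has
determinant one and acts on the projected arc without changing `f`. -/
lemma evalAt_tailShift_eq {n : ℕ} {f : PolyFun n}
    (hf : ∀ (g : Matrix.SpecialLinearGroup (Fin (n + 1)) ℂ) a, evalAt (linAct g.1 a) f = evalAt a f)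
    {a : Series (n + 1)} (M M' : Matrix.SpecialLinearGroup (Fin (n + 2)) ℂ)
    (hM : SendsToFirst M.1 a) (hM' : SendsToFirst M'.1 a) :
    evalAt (tailShift (linAct M.1 a)) f = evalAt (tailShift (linAct M'.1 a)) f := by
  have h1 : M' = (M' * M⁻¹) * M := by simp
  have hN : Matrix.mulVec (M' * M⁻¹).1 (Pi.single 0 1) = Pi.single 0 1 := by
    rw [← hM, Matrix.mulVec_mulVec, ← Matrix.SpecialLinearGroup.coe_mul, ← h1, hM', hM]
  obtain ⟨h00, h0⟩ := col_zero_of_mulVec hN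
  have hdet := det_eq_mul_det_submatrix _ h0
  rw [(M' * M⁻¹).2, h00, one_mul] at hdet
  have := hf ⟨_, hdet.symm⟩ (tailShift (linAct M.1 a))
  rw [← this, ← tailShift_linAct _ h0, ← linAct_mul, ← Matrix.SpecialLinearGroup.coe_mul, ← h1]

/-- A unimodular matrix that maps `x` to the first basis vector, when `x 0 ≠ 0`. -/
def chartMatrix {n : ℕ} (x : Fin (n + 2) → ℂ) : Matrix (Fin (n + 2)) (Fin (n + 2)) ℂ :=
  Matrix.of fun i j => if i = 0 then (if j = 0 then (x 0)⁻¹ else 0) else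
    -- The factor `x 0` in row `1` cancels `(x 0)⁻¹` in row `0`, which makes the determinant one.
    (if i = 1 then x 0 else 1) * ((if i = j then 1 else 0) - if j = 0 then x i / x 0 else 0)

lemma det_chartMatrix {n : ℕ} {x : Fin (n + 2) → ℂ} (hx : x 0 ≠ 0) : (chartMatrix x).det = 1 := by
  rw [Matrix.det_of_isLowerTriangular]
  · rw [Fin.prod_univ_succ, Fin.prod_univ_succ, Finset.prod_eq_one]
    · simp [chartMatrix, hx]
    · intro i _
      have : (i.succ.succ : Fin (n + 2)) ≠ 1 := by
        rw [← Fin.succ_zero_eq_one, Ne, Fin.succ_inj]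
        exact Fin.succ_ne_zero i
      simp [chartMatrix, this]
  · intro i j hij
    have hij' : i < j := hij
    have hj : j ≠ 0 := fun h => by simp [h] at hij'
    simp [chartMatrix, hij'.ne, hj]

lemma chartMatrix_mulVec {n : ℕ} {x : Fin (n + 2) → ℂ} (hx : x 0 ≠ 0) :
    Matrix.mulVec (chartMatrix x) x = Pi.single 0 1 := by
  funext i
  rw [Matrix.mulVec, dotProduct]
  rcases eq_or_ne i 0 with rfl | hi
  · simp [chartMatrix, hx]
  · simp only [chartMatrix, Matrix.of_apply, hi, if_false, mul_assoc]
    rw [← Finset.mul_sum]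
    simp [sub_mul, Finset.sum_sub_distrib, hx, hi]

/-- `chartMatrix` as an element of the special linear group. -/
def chartSL {n : ℕ} {x : Fin (n + 2) → ℂ} (hx : x 0 ≠ 0) :
    Matrix.SpecialLinearGroup (Fin (n + 2)) ℂ :=
  ⟨chartMatrix x, det_chartMatrix hx⟩

@[simp] lemma coe_chartSL {n : ℕ} {x : Fin (n + 2) → ℂ} (hx : x 0 ≠ 0) :
    (chartSL hx).1 = chartMatrix x := rfl

lemma exists_sendsToFirst {n : ℕ} {a : Series (n + 1)} (ha : coeffVec 0 a ≠ 0) :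
    ∃ M : Matrix.SpecialLinearGroup (Fin (n + 2)) ℂ, SendsToFirst M.1 a := by
  obtain ⟨g, hg⟩ : ∃ g : Matrix.SpecialLinearGroup (Fin (n + 2)) ℂ,
      Matrix.mulVec g.1 (coeffVec 0 a) 0 ≠ 0 := by
    by_cases h0 : coeffVec 0 a 0 = 0
    · obtain ⟨i, hi⟩ := Function.ne_iff.1 ha
      have hi0 : (0 : Fin (n + 2)) ≠ i := fun h => hi (h ▸ h0)
      refine ⟨Matrix.SpecialLinearGroup.transvection hi0 1, ?_⟩
      rw [Matrix.SpecialLinearGroup.transvection_coe, Matrix.add_mulVec, Matrix.one_mulVec,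
        Pi.add_apply, h0, zero_add, Matrix.single_mulVec]
      simpa using hi
    · exact ⟨1, by simpa using h0⟩
  refine ⟨chartSL hg * g, ?_⟩
  rw [SendsToFirst, Matrix.SpecialLinearGroup.coe_mul, ← Matrix.mulVec_mulVec]
  exact chartMatrix_mulVec hg

lemma IsSmooth.coeffVec_zero_ne {n : ℕ} {a : Series n} (ha : IsSmooth a) : coeffVec 0 a ≠ 0 := by
  have := LinearIndependent.ne_zero 0 ha
  simpa using this

/-- `P` is the pullback of `f` under the projection from the initial point of an arc. -/
def IsLift {n : ℕ} (f : PolyFun n) (P : PolyFun (n + 1)) : Prop :=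
  ∀ a : Series (n + 1), coeffVec 0 a 0 ≠ 0 →
    evalAt a P = evalAt (tailShift (linAct (chartMatrix (coeffVec 0 a)) a)) f

lemma coeff_chart {n : ℕ} {a : Series (n + 1)} (ha : coeffVec 0 a 0 ≠ 0) (i : Fin (n + 1)) (j : ℕ) :
    coeffVec 0 a 0 * PowerSeries.coeff j
      (tailShift (linAct (chartMatrix (coeffVec 0 a)) a) i) =
    evalAt a ((if i = 0 then MvPolynomial.X (0, 0) else 1) *
      (MvPolynomial.X (0, 0) * MvPolynomial.X (i.succ, j + 1) -
        MvPolynomial.X (i.succ, 0) * MvPolynomial.X (0, j + 1))) := by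
  rw [coeff_tailShift, coeff_linAct]
  have h1 : (i.succ = 1) = (i = 0) := by
    rw [← Fin.succ_zero_eq_one, Fin.succ_inj]
  simp only [chartMatrix, Matrix.of_apply, Fin.succ_ne_zero, if_false, mul_assoc, sub_mul, ite_mul,
      one_mul, zero_mul, h1]
  simp only [mul_sub, mul_ite, mul_zero]
  have h2 (z : ℂ) : coeffVec 0 a 0 * (coeffVec 0 a i.succ / coeffVec 0 a 0 * z) =
      coeffVec 0 a i.succ * z := by field_simp
  split_ifs with hi <;>
    simp [Finset.sum_sub_distrib, mul_sub, h2] <;> simp [coeffVec]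

lemma exists_chart_numerator {n : ℕ} (f : PolyFun n) : ∃ (N : ℕ) (Q : PolyFun (n + 1)),
    ∀ a : Series (n + 1), coeffVec 0 a 0 ≠ 0 → evalAt a Q =
      coeffVec 0 a 0 ^ N * evalAt (tailShift (linAct (chartMatrix (coeffVec 0 a)) a)) f := by
  induction f using MvPolynomial.induction_on with
  | C c => exact ⟨0, MvPolynomial.C c, fun a _ => by simp⟩
  | add p q hp hq =>
    obtain ⟨N, Q, hQ⟩ := hp
    obtain ⟨N', Q', hQ'⟩ := hq
    refine ⟨N + N', Q * MvPolynomial.X (0, 0) ^ N' + Q' * MvPolynomial.X (0, 0) ^ N,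
      fun a ha => ?_⟩
    have : PowerSeries.coeff 0 (a 0) = coeffVec 0 a 0 := rfl
    simp only [evalAt_add, evalAt_mul, evalAt_pow, evalAt_X, hQ a ha, hQ' a ha, this]
    ring
  | mul_X p ij hp =>
    obtain ⟨i, j⟩ := ij
    obtain ⟨N, Q, hQ⟩ := hp
    refine ⟨N + 1, Q * ((if i = 0 then MvPolynomial.X (0, 0) else 1) *
      (MvPolynomial.X (0, 0) * MvPolynomial.X (i.succ, j + 1) -
        MvPolynomial.X (i.succ, 0) * MvPolynomial.X (0, j + 1))), fun a ha => ?_⟩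
    rw [evalAt_mul, ← coeff_chart ha, hQ a ha, evalAt_mul, evalAt_X]
    ring

lemma sendsToFirst_chart {n : ℕ} {a : Series (n + 1)} (ha : coeffVec 0 a 0 ≠ 0) :
    SendsToFirst (chartSL ha).1 a :=
  chartMatrix_mulVec ha

lemma IsLift.unique {n : ℕ} {f : PolyFun n} {P P' : PolyFun (n + 1)} (h : IsLift f P)
    (h' : IsLift f P') : P = P' :=
  eq_of_evalAt_of_ne_zero (MvPolynomial.X_ne_zero (0, 0)) fun a ha => by
    rw [evalAt_X] at ha
    rw [h a ha, h' a ha]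

/-- The two charts `a_00 ≠ 0` and `a_00 + a_10 ≠ 0` give the same function on their overlap, with
denominators powers of two coprime linear forms. Hence the denominator `X0 ^ N` divides the
numerator `Q`. -/
lemma exists_isLift {n : ℕ} {f : PolyFun n}
    (hf : ∀ (g : Matrix.SpecialLinearGroup (Fin (n + 1)) ℂ) a,
      evalAt (linAct g.1 a) f = evalAt a f) : ∃ P, IsLift f P := by
  obtain ⟨N, Q, hQ⟩ := exists_chart_numerator f
  have h01 : (0 : Fin (n + 2)) ≠ 1 := by simp
  set g := Matrix.SpecialLinearGroup.transvection (F := ℂ) h01 1 with hg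
  have hga (a : Series (n + 1)) :
      coeffVec 0 (linAct g.1 a) 0 = coeffVec 0 a 0 + coeffVec 0 a 1 := by
    rw [coeffVec_linAct, hg, Matrix.SpecialLinearGroup.transvection_coe, Matrix.add_mulVec,
      Matrix.one_mulVec, Pi.add_apply, Matrix.single_mulVec]
    simp
  obtain ⟨Q', hQ'⟩ := (IsPolyMap.linAct g.1).exists_pullback Q
  set X0 : PolyFun (n + 1) := MvPolynomial.X (0, 0) with hX0
  set X1 : PolyFun (n + 1) := MvPolynomial.X (1, 0) with hX1
  have hX0a (a : Series (n + 1)) : evalAt a X0 = coeffVec 0 a 0 := evalAt_X _ _ _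
  have hX1a (a : Series (n + 1)) : evalAt a X1 = coeffVec 0 a 1 := evalAt_X _ _ _
  have hX01 : X0 + X1 ≠ 0 := by
    intro h
    have := congrArg (evalAt fun _ => (1 : PowerSeries ℂ)) h
    simp [hX0a, hX1a, coeffVec] at this
  have key : (X0 + X1) ^ N * Q = X0 ^ N * Q' := by
    refine eq_of_evalAt_of_ne_zero (mul_ne_zero (MvPolynomial.X_ne_zero (0, 0)) hX01) fun a ha => ?_
    rw [evalAt_mul, evalAt_add, hX0a, hX1a] at ha
    have h0 : coeffVec 0 a 0 ≠ 0 := left_ne_zero_of_mul ha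
    have h1 : coeffVec 0 (linAct g.1 a) 0 ≠ 0 := by
      rw [hga]
      exact right_ne_zero_of_mul ha
    have h2 : SendsToFirst (chartSL h1 * g).1 a := by
      rw [SendsToFirst, Matrix.SpecialLinearGroup.coe_mul, ← Matrix.mulVec_mulVec,
        ← coeffVec_linAct]
      exact chartMatrix_mulVec h1
    have h3 := evalAt_tailShift_eq hf _ _ (sendsToFirst_chart h0) h2
    rw [Matrix.SpecialLinearGroup.coe_mul, linAct_mul, coe_chartSL, coe_chartSL] at h3
    simp only [evalAt_mul, evalAt_pow, evalAt_add, hX0a, hX1a]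
    rw [hQ a h0, hQ', hQ _ h1, hga, h3]
    ring
  have hprime : Prime X0 := MvPolynomial.X_prime
  have hndvd : ¬ X0 ∣ (X0 + X1) ^ N := by
    intro h
    have h1 := (dvd_add_right dvd_rfl).1 (hprime.dvd_of_dvd_pow h)
    rw [hX0, hX1, MvPolynomial.X_dvd_X] at h1
    simp at h1
  obtain ⟨P, hP⟩ := hprime.pow_dvd_of_dvd_mul_left N hndvd ⟨Q', key⟩
  refine ⟨P, fun a ha => mul_left_cancel₀ (pow_ne_zero N ha) ?_⟩
  rw [← hQ a ha, hP, evalAt_mul, evalAt_pow, hX0a]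

lemma IsLift.evalAt_linAct {n : ℕ} {f : PolyFun n}
    (hf : ∀ (g : Matrix.SpecialLinearGroup (Fin (n + 1)) ℂ) a,
      evalAt (linAct g.1 a) f = evalAt a f)
    {P : PolyFun (n + 1)} (hP : IsLift f P)
    (g : Matrix.SpecialLinearGroup (Fin (n + 2)) ℂ) (a : Series (n + 1)) :
    evalAt (linAct g.1 a) P = evalAt a P := by
  obtain ⟨h, hh⟩ := (IsPolyMap.linAct g.1).exists_pullback (MvPolynomial.X (0, 0) : PolyFun (n + 1))
  have hh0 : h ≠ 0 := by
    rintro rfl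
    have := hh (linAct g⁻¹.1 fun _ => 1)
    rw [← linAct_mul, ← Matrix.SpecialLinearGroup.coe_mul, mul_inv_cancel,
      Matrix.SpecialLinearGroup.coe_one, linAct_one] at this
    simp at this
  have := (IsPolyMap.linAct g.1).evalAt_eq IsPolyMap.id (c := 1) (f := P) (g := P)
    (mul_ne_zero (MvPolynomial.X_ne_zero ((0 : Fin (n + 2)), 0)) hh0) (fun b hb => ?_) a
  · rwa [one_mul] at this
  · rw [evalAt_mul, hh, evalAt_X, evalAt_X] at hb
    have h0 : coeffVec 0 b 0 ≠ 0 := left_ne_zero_of_mul hb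
    have h1 : coeffVec 0 (linAct g.1 b) 0 ≠ 0 := right_ne_zero_of_mul hb
    have h2 : SendsToFirst (chartSL h1 * g).1 b := by
      rw [SendsToFirst, Matrix.SpecialLinearGroup.coe_mul, ← Matrix.mulVec_mulVec,
        ← coeffVec_linAct]
      exact chartMatrix_mulVec h1
    have h3 := evalAt_tailShift_eq hf _ _ (sendsToFirst_chart h0) h2
    rw [Matrix.SpecialLinearGroup.coe_mul, linAct_mul, coe_chartSL, coe_chartSL] at h3
    rw [one_mul, hP b h0, hP _ h1, h3]

lemma IsLift.evalAt_eq {n : ℕ} {f : PolyFun n}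
    (hf : ∀ (g : Matrix.SpecialLinearGroup (Fin (n + 1)) ℂ) a,
      evalAt (linAct g.1 a) f = evalAt a f)
    {P : PolyFun (n + 1)} (hP : IsLift f P) {a : Series (n + 1)}
    (M : Matrix.SpecialLinearGroup (Fin (n + 2)) ℂ) (hM : SendsToFirst M.1 a) :
    evalAt a P = evalAt (tailShift (linAct M.1 a)) f := by
  have h0 : coeffVec 0 (linAct M.1 a) = Pi.single 0 1 := by rw [coeffVec_linAct, hM]
  have h1 : coeffVec 0 (linAct M.1 a) 0 ≠ 0 := by simp [h0]
  rw [← IsLift.evalAt_linAct hf hP M, hP _ h1]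
  refine (evalAt_tailShift_eq hf (chartSL h1) 1 (sendsToFirst_chart h1) ?_).trans
    (by simp [linAct_one])
  rw [SendsToFirst, Matrix.SpecialLinearGroup.coe_one, Matrix.one_mulVec, h0]

lemma linAct_reparam {n : ℕ} (g : Matrix (Fin (n + 1)) (Fin (n + 1)) ℂ) (u : PowerSeries ℂ)
    {v : PowerSeries ℂ} (hv : PowerSeries.coeff 0 v = 0) (a : Series n) :
    linAct g (reparam u v a) = reparam u v (linAct g a) := by
  funext i
  simp only [linAct, reparam, ← PowerSeries.coe_substAlgHom (hasSubst_of_coeff_zero hv), map_sum,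
    map_smul, Finset.mul_sum, mul_smul_comm]

/-- Substituting `v = t w` in `t b'` and dividing by `t` leaves an extra factor `w`; this is why the
degree of `f` enters the weight of its lift. -/
lemma tailShift_reparam {n : ℕ} (u w : PowerSeries ℂ) {b : Series (n + 1)}
    (hb : ∀ i : Fin (n + 1), PowerSeries.coeff 0 (b i.succ) = 0) :
    tailShift (reparam u (PowerSeries.X * w) b) =
      reparam (u * w) (PowerSeries.X * w) (tailShift b) := by
  have hv : PowerSeries.coeff 0 (PowerSeries.X * w) = 0 := by simp
  ext i j
  have h1 : b i.succ = PowerSeries.X * tailShift b i := by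
    ext k
    cases k with
    | zero => simpa using hb i
    | succ k => rw [PowerSeries.coeff_succ_X_mul, coeff_tailShift]
  rw [coeff_tailShift]
  simp only [reparam]
  rw [h1, PowerSeries.subst_mul (hasSubst_of_coeff_zero hv),
    PowerSeries.subst_X (hasSubst_of_coeff_zero hv)]
  rw [show u * (PowerSeries.X * w * PowerSeries.subst (PowerSeries.X * w) (tailShift b i)) =
    PowerSeries.X * (u * w * PowerSeries.subst (PowerSeries.X * w) (tailShift b i)) by ring,
    PowerSeries.coeff_succ_X_mul]

lemma coeffVec_zero_reparam {n : ℕ} (u : PowerSeries ℂ) {v : PowerSeries ℂ}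
    (hv : PowerSeries.coeff 0 v = 0) (a : Series n) :
    coeffVec 0 (reparam u v a) = PowerSeries.coeff 0 u • coeffVec 0 a := by
  funext i
  simp [coeffVec, coeff_reparam hv]

/-- The bidegree of the lift of a differential invariant. -/
theorem IsLift.mem_invariants {n : ℕ} (hn : 0 < n) {f : PolyFun n} {d ϖ : ℤ}
    (hf : f ∈ invariants n ((n + 1 : ℕ) * d) ϖ) {P : PolyFun (n + 1)} (hP : IsLift f P) :
    P ∈ invariants (n + 1) (((n + 1 : ℕ) + 1) * d) (ϖ + (n + 1 : ℕ) * d) := by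
  have hf' := fun g a => evalAt_linAct_of_mem hn hf a g
  refine ⟨fun a u v ha hu hv => ?_, fun g a _ => IsLift.evalAt_linAct hf' hP g a⟩
  have hu0 : PowerSeries.coeff 0 u ≠ 0 := hu
  obtain ⟨M, hM⟩ := exists_sendsToFirst ha.coeffVec_zero_ne
  obtain ⟨M', hM'⟩ := exists_sendsToFirst (a := reparam u v a) (by
    rw [coeffVec_zero_reparam u hv.1]
    exact smul_ne_zero hu0 ha.coeffVec_zero_ne)
  rw [IsLift.evalAt_eq hf' hP M hM, IsLift.evalAt_eq hf' hP M' hM']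
  have h1 : M' = (M' * M⁻¹) * M := by simp
  have hN : Matrix.mulVec (M' * M⁻¹).1 (Pi.single 0 1) =
      Pi.single 0 (PowerSeries.coeff 0 u)⁻¹ := by
    have h2 : (PowerSeries.coeff 0 u) • Matrix.mulVec (M' * M⁻¹).1 (Pi.single 0 1) =
        Pi.single 0 1 := by
      rw [← hM, Matrix.mulVec_mulVec, ← Matrix.SpecialLinearGroup.coe_mul, ← h1,
        ← Matrix.mulVec_smul, ← coeffVec_zero_reparam u hv.1, hM', hM]
    rw [← inv_smul_smul₀ hu0 (Matrix.mulVec (M' * M⁻¹).1 (Pi.single 0 1)), h2]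
    funext i
    simp [Pi.single_apply]
  obtain ⟨h00, h0⟩ := col_zero_of_mulVec hN
  have hdet := det_eq_mul_det_submatrix _ h0
  rw [(M' * M⁻¹).2, h00] at hdet
  -- Scaling `a_0` by `u_0` is compensated in the lower block, which acquires determinant `u_0`. As
  -- the degree is `(n + 1) d`, this contributes a further factor `u_0 ^ d`.
  have hdet' : ((M' * M⁻¹).1.submatrix Fin.succ Fin.succ).det = PowerSeries.coeff 0 u := by
    field_simp at hdet
    exact hdet.symm
  obtain ⟨c, hc⟩ := IsAlgClosed.exists_pow_nat_eq (PowerSeries.coeff 0 u) n.succ_pos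
  have hc0 : c ≠ 0 := by
    rintro rfl
    rw [zero_pow n.succ_ne_zero] at hc
    exact hu0 hc.symm
  obtain ⟨w, rfl⟩ := PowerSeries.X_dvd_iff.2 (by simpa using hv.1)
  have hw : PowerSeries.coeff 1 (PowerSeries.X * w) = PowerSeries.coeff 0 w := coeff_one_X_mul w
  have hw0 : PowerSeries.coeff 0 w ≠ 0 := by
    rw [← hw]
    exact hv.2
  have hb : ∀ i : Fin (n + 1), PowerSeries.coeff 0 (linAct M.1 a i.succ) = 0 := fun i => by
    have := congrFun hM i.succ
    rw [← coeffVec_linAct] at this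
    simpa [coeffVec] using this
  have huw : PowerSeries.coeff 0 (u * w) = PowerSeries.coeff 0 u * PowerSeries.coeff 0 w := by
    simp
  rw [h1, Matrix.SpecialLinearGroup.coe_mul, linAct_mul, tailShift_linAct _ h0,
    evalAt_linAct_of_pow_eq_det hn hf _ _ hc0 (hc.trans hdet'.symm), linAct_reparam _ _ hv.1,
    tailShift_reparam u w hb, evalAt_reparam_of_mem hn hf _ (u := u * w)
      (by rw [IsUnitSeries, huw]; exact mul_ne_zero hu0 hw0) hv, huw, hw, mul_zpow, zpow_mul c,
    zpow_natCast, hc, add_mul, one_mul, zpow_add₀ hu0, zpow_add₀ hw0]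
  ring

section LiftAlgebra

variable {n : ℕ} {f g : PolyFun n} {P Q : PolyFun (n + 1)}

lemma IsLift.add (hP : IsLift f P) (hQ : IsLift g Q) : IsLift (f + g) (P + Q) := fun a ha => by
  rw [evalAt_add, evalAt_add, hP a ha, hQ a ha]

lemma IsLift.mul (hP : IsLift f P) (hQ : IsLift g Q) : IsLift (f * g) (P * Q) := fun a ha => by
  rw [evalAt_mul, evalAt_mul, hP a ha, hQ a ha]

lemma isLift_C (c : ℂ) : IsLift (n := n) (MvPolynomial.C c) (MvPolynomial.C c) := fun a _ => by
  rw [evalAt_C, evalAt_C]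

lemma isLift_zero : IsLift (0 : PolyFun n) 0 := fun a _ => by rw [evalAt_zero, evalAt_zero]

lemma isLift_sum {ι : Type*} (s : Finset ι) (F : ι → PolyFun n) (G : ι → PolyFun (n + 1))
    (h : ∀ i ∈ s, IsLift (F i) (G i)) : IsLift (∑ i ∈ s, F i) (∑ i ∈ s, G i) := fun a ha => by
  rw [evalAt_sum, evalAt_sum]
  exact Finset.sum_congr rfl fun i hi => h i hi a ha

end LiftAlgebra

lemma exists_isLift_of_mem_invariants {n : ℕ} (hn : 0 < n) {f : PolyFun n} {δ ϖ : ℤ}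
    (hf : f ∈ invariants n δ ϖ) : ∃ P ∈ invariants (n + 1) (δ + δ / (n + 1 : ℕ)) (ϖ + δ),
      IsLift f P := by
  rcases eq_or_ne f 0 with rfl | hf0
  · exact ⟨0, zero_mem _, isLift_zero⟩
  obtain ⟨d, rfl⟩ := succ_dvd_degree hn hf0 hf
  obtain ⟨P, hP⟩ := exists_isLift fun g a => evalAt_linAct_of_mem hn hf a g
  refine ⟨P, ?_, hP⟩
  have h1 : ((n + 1 : ℕ) : ℤ) * d / (n + 1 : ℕ) = d :=
    Int.mul_ediv_cancel_left _ (Int.natCast_ne_zero.2 n.succ_ne_zero)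
  have h2 : ((n + 1 : ℕ) : ℤ) * d + d = ((n + 1 : ℕ) + 1) * d := by ring
  rw [h1, h2]
  exact hP.mem_invariants hn hf

lemma exists_isLift_of_mem_invariantRing {n : ℕ} (hn : 0 < n) {f : PolyFun n}
    (hf : f ∈ invariantRing n) : ∃ P ∈ invariantRing (n + 1), IsLift f P := by
  rw [mem_invariantRing_iff] at hf
  induction hf using Submodule.iSup_induction' with
  | mem e x hx =>
    obtain ⟨P, hP, hPl⟩ := exists_isLift_of_mem_invariants hn hx
    exact ⟨P, mem_invariantRing_of_mem hP, hPl⟩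
  | zero => exact ⟨0, zero_mem _, isLift_zero⟩
  | add x y _ _ hx hy =>
    obtain ⟨P, hP, hPl⟩ := hx
    obtain ⟨Q, hQ, hQl⟩ := hy
    exact ⟨P + Q, add_mem hP hQ, hPl.add hQl⟩

/-- The pullback of differential invariants under the projection from the initial point. -/
def liftHom {n : ℕ} (hn : 0 < n) : invariantRing n →ₐ[ℂ] invariantRing (n + 1) :=
  have spec (I : invariantRing n) :=
    (exists_isLift_of_mem_invariantRing hn I.2).choose_spec
  { toFun := fun I => ⟨_, (spec I).1⟩
    map_one' := Subtype.ext ((spec 1).2.unique (by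
      simpa using isLift_C (n := n) 1))
    map_mul' := fun I J => Subtype.ext ((spec (I * J)).2.unique ((spec I).2.mul (spec J).2))
    map_zero' := Subtype.ext ((spec 0).2.unique isLift_zero)
    map_add' := fun I J => Subtype.ext ((spec (I + J)).2.unique ((spec I).2.add (spec J).2))
    commutes' := fun c => Subtype.ext ((spec _).2.unique (isLift_C c)) }

lemma isLift_liftHom {n : ℕ} (hn : 0 < n) (I : invariantRing n) :
    IsLift (I : PolyFun n) (liftHom hn I : PolyFun (n + 1)) :=
  (exists_isLift_of_mem_invariantRing hn I.2).choose_spec.2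

lemma liftHom_hasReducedBidegree {n : ℕ} (hn : 0 < n) {I : invariantRing n} {d p : ℤ}
    (h : HasReducedBidegree I d p) : HasReducedBidegree (liftHom hn I) d p := by
  have h1 : (I : PolyFun n) ∈ invariants n ((n + 1 : ℕ) * d)
      (p + ((n + 1).choose 2 : ℤ) * d) := by
    have := h
    rw [HasReducedBidegree] at this
    push_cast
    exact this
  have h2 := (isLift_liftHom hn I).mem_invariants hn h1
  rw [HasReducedBidegree]
  -- Pascal's rule absorbs the shift `(n + 1) d` of the weight, so the reduced weight stays `p`.
  have h3 : p + ((n + 1).choose 2 : ℤ) * d + (n + 1 : ℕ) * d =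
      p + ((n + 1 + 1).choose 2 : ℤ) * d := by
    rw [Nat.choose_succ_succ' (n + 1) 1, Nat.choose_one_right]
    push_cast
    ring
  rwa [h3] at h2

/-! ### Slices and injectivity of the lift -/

/-- An arc whose projection from its initial point is a given one. -/
def slice {n : ℕ} (b : Series n) : Series (n + 1) :=
  Fin.cons 1 fun i => PowerSeries.X * b i

lemma coeffVec_zero_slice {n : ℕ} (b : Series n) : coeffVec 0 (slice b) = Pi.single 0 1 := by
  funext i
  refine Fin.cases ?_ (fun i => ?_) i <;> simp [coeffVec, slice]

lemma coeffVec_succ_slice {n : ℕ} (b : Series n) (j : ℕ) :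
    coeffVec (j + 1) (slice b) = Fin.cons 0 (coeffVec j b) := by
  funext i
  refine Fin.cases ?_ (fun i => ?_) i
  · simp [coeffVec, slice, PowerSeries.coeff_one]
  · simp only [coeffVec, slice, Fin.cons_succ]
    rw [PowerSeries.coeff_succ_X_mul]

lemma tailShift_slice {n : ℕ} (b : Series n) : tailShift (slice b) = b := by
  ext i j
  rw [coeff_tailShift]
  simp only [slice, Fin.cons_succ]
  rw [PowerSeries.coeff_succ_X_mul]

lemma evalAt_slice_liftHom {n : ℕ} (hn : 0 < n) (I : invariantRing n) (b : Series n) :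
    evalAt (slice b) (liftHom hn I : PolyFun (n + 1)) = evalAt b (I : PolyFun n) := by
  have := IsLift.evalAt_eq (fun g a => evalAt_linAct_of_mem_invariantRing hn I.2 g a)
    (isLift_liftHom hn I) (a := slice b) 1 (by
      rw [SendsToFirst, Matrix.SpecialLinearGroup.coe_one, Matrix.one_mulVec, coeffVec_zero_slice])
  rw [this, Matrix.SpecialLinearGroup.coe_one, linAct_one, tailShift_slice]

lemma liftHom_injective {n : ℕ} (hn : 0 < n) : Function.Injective (liftHom hn) := by
  rw [injective_iff_map_eq_zero]
  intro I hI
  refine Subtype.ext (eq_of_evalAt fun b => ?_)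
  rw [← evalAt_slice_liftHom hn, hI]
  simp

/-! ### Vanishing on germs and the projection property -/

section Germs

variable {n : ℕ}

lemma evalAt_eq_zero_iff_of_germ_eq {f : PolyFun n} {δ ϖ : ℤ} (hf : f ∈ invariants n δ ϖ)
    {a b : ParamArc n} (h : a.germ = b.germ) : evalAt a.1 f = 0 ↔ evalAt b.1 f = 0 := by
  have := Quot.eqvGen_exact h
  induction this with
  | rel x y hxy =>
    obtain ⟨u, v, hu, hv, h⟩ := hxy
    rw [h, hf.1 _ u v x.2 hu hv]
    simp only [mul_eq_zero, zpow_ne_zero ϖ hv.2, zpow_ne_zero δ (show PowerSeries.coeff 0 u ≠ 0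
      from hu), false_or]
  | refl x => rfl
  | symm x y _ ih => exact (ih (Quot.eqvGen_sound ‹_›)).symm
  | trans x y z _ _ ih1 ih2 =>
    exact (ih1 (Quot.eqvGen_sound ‹_›)).trans (ih2 (Quot.eqvGen_sound ‹_›))

lemma vanishesOn_germ_iff {I : invariantRing n} {δ ϖ : ℤ}
    (hI : (I : PolyFun n) ∈ invariants n δ ϖ) (a : ParamArc n) :
    VanishesOn I a.germ ↔ evalAt a.1 (I : PolyFun n) = 0 :=
  ⟨fun h => h a rfl, fun h _ hb => (evalAt_eq_zero_iff_of_germ_eq hI hb).2 h⟩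

/-- The character of the torus of weight `e`. -/
def torusChar (e : ℤ × ℤ) : ℂˣ × ℂˣ →* ℂ :=
  (Units.coeHom ℂ).comp ((zpowGroupHom e.1).comp (MonoidHom.fst ℂˣ ℂˣ) *
    (zpowGroupHom e.2).comp (MonoidHom.snd ℂˣ ℂˣ))

lemma torusChar_apply (e : ℤ × ℤ) (x : ℂˣ × ℂˣ) :
    torusChar e x = (x.1 : ℂ) ^ e.1 * (x.2 : ℂ) ^ e.2 := by
  simp [torusChar]

lemma torusChar_injective : Function.Injective torusChar := by
  intro e e' h
  have h1 := DFunLike.congr_fun h (Units.mk0 2 two_ne_zero, 1)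
  have h2 := DFunLike.congr_fun h (1, Units.mk0 2 two_ne_zero)
  simp only [torusChar_apply, Units.val_mk0, Units.val_one, one_zpow, mul_one, one_mul] at h1 h2
  exact Prod.ext (two_zpow_injective h1) (two_zpow_injective h2)

lemma exists_torus_paramArc (a : ParamArc n) (x : ℂˣ × ℂˣ) : ∃ b : ParamArc n, b.germ = a.germ ∧
    b.1 = reparam (PowerSeries.C (x.1 : ℂ)) (PowerSeries.X * PowerSeries.C (x.2 : ℂ)) a.1 := by
  have h0 : PowerSeries.coeff 0 (PowerSeries.C (x.2 : ℂ)) ≠ 0 := by simp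
  refine ⟨⟨reparam (PowerSeries.C (x.1 : ℂ)) (PowerSeries.X * PowerSeries.C (x.2 : ℂ)) a.1, ?_⟩,
    (Quot.sound ⟨_, _, isUnitSeries_C x.1.ne_zero, isParamChange_X_mul h0, rfl⟩).symm, rfl⟩
  have ha := a.2
  rw [IsSmooth, LinearIndependent.pair_iff] at ha ⊢
  intro s t hst
  have h1 := ha (s * x.1) (t * (x.1 * x.2)) (by
    rw [← hst]
    funext i
    simp only [reparam_C, Pi.add_apply, Pi.smul_apply, coeffVec, coeff_torus, smul_eq_mul]
    ring)
  simpa using h1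

/-- The representatives of a germ are stable under a two-dimensional torus, on which components of
different bidegrees transform by different characters. Independence of characters separates them. -/
lemma vanishesOn_sum_iff {I : invariantRing n} {ι : Type*} (s : Finset ι) (F : ι → PolyFun n)
    (ε : ι → ℤ × ℤ) (hε : Set.InjOn ε s) (hF : ∀ i ∈ s, F i ∈ invariants n (ε i).1 (ε i).2)
    (hI : (I : PolyFun n) = ∑ i ∈ s, F i) (a : ParamArc n) :
    VanishesOn I a.germ ↔ ∀ i ∈ s, evalAt a.1 (F i) = 0 := by
  constructor
  · intro h
    have hli : LinearIndependent ℂ (fun i : s => (torusChar (ε i) : ℂˣ × ℂˣ → ℂ)) :=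
      (linearIndependent_monoidHom (ℂˣ × ℂˣ) ℂ).comp (fun i : s => torusChar (ε i))
        (fun i j hij => Subtype.ext (hε i.2 j.2 (torusChar_injective hij)))
    have := linearIndependent_iff'.1 hli Finset.univ (fun i => evalAt a.1 (F i)) (by
      funext x
      obtain ⟨b, hb, hb'⟩ := exists_torus_paramArc a x
      have h0 := h b hb
      rw [hI, evalAt_sum, ← Finset.sum_coe_sort] at h0
      simp only [Finset.sum_apply, Pi.smul_apply, smul_eq_mul, Pi.zero_apply]
      rw [← h0]
      refine Finset.sum_congr rfl fun i _ => ?_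
      have h2 : PowerSeries.coeff 0 (PowerSeries.C (x.2 : ℂ)) ≠ 0 := by simp
      rw [hb', (hF i i.2).1 _ _ _ a.2 (isUnitSeries_C x.1.ne_zero) (isParamChange_X_mul h2),
        coeff_one_X_mul, torusChar_apply]
      simp [mul_comm])
    exact fun i hi => this ⟨i, hi⟩ (Finset.mem_univ _)
  · intro h b hb
    rw [hI, evalAt_sum]
    exact Finset.sum_eq_zero fun i hi => (evalAt_eq_zero_iff_of_germ_eq (hF i hi) hb).2 (h i hi)

lemma exists_bihomogeneous_decomposition (I : invariantRing n) :
    ∃ (s : Finset (ℤ × ℤ)) (F : ℤ × ℤ → PolyFun n),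
      (∀ e ∈ s, F e ∈ invariants n e.1 e.2 ∧ F e ≠ 0) ∧ (I : PolyFun n) = ∑ e ∈ s, F e := by
  classical
  obtain ⟨f, hf⟩ := (Submodule.mem_iSup_iff_exists_dfinsupp' _ _).1 (mem_invariantRing_iff.1 I.2)
  refine ⟨f.support, fun e => f e, fun e he => ⟨(f e).2, fun h => ?_⟩, hf.symm⟩
  exact (DFinsupp.mem_support_iff.1 he) (Subtype.ext h)

end Germs

/-- A projection from the initial point, in any coordinates, is linearly equivalent to the standard
one. -/
lemma exists_eq_linAct_tailShift {n : ℕ} {a : Series (n + 1)} {b : Series n}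
    {π : (Fin (n + 2) → ℂ) →ₗ[ℂ] (Fin (n + 1) → ℂ)}
    (hker : LinearMap.ker π = Submodule.span ℂ {coeffVec 0 a})
    (hb : ∀ j, coeffVec j b = π (coeffVec (j + 1) a))
    (M : Matrix.SpecialLinearGroup (Fin (n + 2)) ℂ) (hM : SendsToFirst M.1 a) :
    ∃ g : Matrix (Fin (n + 1)) (Fin (n + 1)) ℂ, g.det ≠ 0 ∧
      b = linAct g (tailShift (linAct M.1 a)) := by
  have hMM (y : Fin (n + 2) → ℂ) : Matrix.mulVec M⁻¹.1 (Matrix.mulVec M.1 y) = y := by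
    rw [Matrix.mulVec_mulVec, ← Matrix.SpecialLinearGroup.coe_mul, inv_mul_cancel,
      Matrix.SpecialLinearGroup.coe_one, Matrix.one_mulVec]
  have hMM' (y : Fin (n + 2) → ℂ) : Matrix.mulVec M.1 (Matrix.mulVec M⁻¹.1 y) = y := by
    rw [Matrix.mulVec_mulVec, ← Matrix.SpecialLinearGroup.coe_mul, mul_inv_cancel,
      Matrix.SpecialLinearGroup.coe_one, Matrix.one_mulVec]
  set g : Matrix (Fin (n + 1)) (Fin (n + 1)) ℂ := Matrix.of fun i k =>
    π (Matrix.mulVec M⁻¹.1 (Pi.single k.succ 1)) i with hg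
  have ha0 : π (coeffVec 0 a) = 0 := by
    rw [← LinearMap.mem_ker, hker]
    exact Submodule.mem_span_singleton_self _
  have key (y : Fin (n + 2) → ℂ) :
      π (Matrix.mulVec M⁻¹.1 y) = Matrix.mulVec g fun k => y k.succ := by
    have hy : y = y 0 • Pi.single 0 1 + ∑ k : Fin (n + 1), y k.succ • Pi.single k.succ 1 := by
      rw [← Fin.sum_univ_succ (fun k => y k • (Pi.single k 1 : Fin (n + 2) → ℂ))]
      exact pi_eq_sum_univ' y
    conv_lhs => rw [hy]
    rw [← hM]
    simp only [Matrix.mulVec_add, Matrix.mulVec_smul, map_add, map_smul, hMM, ha0, smul_zero,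
      zero_add, Matrix.mulVec_sum, map_sum]
    funext i
    simp [Matrix.mulVec, dotProduct, hg, mul_comm]
  refine ⟨g, fun hdet => ?_, ?_⟩
  · obtain ⟨z, hz0, hz⟩ := Matrix.exists_mulVec_eq_zero_iff.2 hdet
    have h1 : π (Matrix.mulVec M⁻¹.1 (Fin.cons 0 z)) = 0 := by
      rw [key, ← hz]
      rfl
    rw [← LinearMap.mem_ker, hker, Submodule.mem_span_singleton] at h1
    obtain ⟨c, hc⟩ := h1
    have h2 := congrArg (Matrix.mulVec M.1) hc
    rw [Matrix.mulVec_smul, hM, hMM'] at h2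
    exact hz0 (funext fun k => by simpa using (congrFun h2 k.succ).symm)
  · ext i j
    have h1 := congrFun (hb j) i
    rw [← hMM (coeffVec (j + 1) a), key, ← coeffVec_linAct] at h1
    rw [coeff_linAct]
    simp only [coeff_tailShift]
    exact h1

lemma evalAt_isLift_eq_zero_iff {n : ℕ} (hn : 0 < n) {f : PolyFun n} {δ ϖ : ℤ}
    (hf : f ∈ invariants n δ ϖ) {P : PolyFun (n + 1)} (hP : IsLift f P) {a : Series (n + 1)}
    (ha : IsSmooth a) {b : Series n} {π : (Fin (n + 2) → ℂ) →ₗ[ℂ] (Fin (n + 1) → ℂ)}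
    (hker : LinearMap.ker π = Submodule.span ℂ {coeffVec 0 a})
    (hb : ∀ j, coeffVec j b = π (coeffVec (j + 1) a)) :
    evalAt a P = 0 ↔ evalAt b f = 0 := by
  obtain ⟨M, hM⟩ := exists_sendsToFirst ha.coeffVec_zero_ne
  obtain ⟨g, hg, rfl⟩ := exists_eq_linAct_tailShift hker hb M hM
  obtain ⟨c, hc⟩ := IsAlgClosed.exists_pow_nat_eq g.det n.succ_pos
  have hc0 : c ≠ 0 := by
    rintro rfl
    rw [zero_pow n.succ_ne_zero] at hc
    exact hg hc.symm
  rw [IsLift.evalAt_eq (fun g a => evalAt_linAct_of_mem hn hf a g) hP M hM,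
    evalAt_linAct_of_pow_eq_det hn hf _ g hc0 hc]
  simp [zpow_ne_zero δ hc0]

theorem liftHom_hasProjectionProperty {n : ℕ} (hn : 0 < n) :
    HasProjectionProperty (liftHom hn) := by
  rintro I c c' ⟨a, b, π, rfl, rfl, hker, hb⟩
  obtain ⟨s, F, hF, hI⟩ := exists_bihomogeneous_decomposition I
  have hex (e : ℤ × ℤ) : ∃ P : PolyFun (n + 1), e ∈ s →
      P ∈ invariants (n + 1) (e.1 + e.1 / (n + 1 : ℕ)) (e.2 + e.1) ∧ IsLift (F e) P := by
    by_cases he : e ∈ s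
    · obtain ⟨P, hP⟩ := exists_isLift_of_mem_invariants hn (hF e he).1
      exact ⟨P, fun _ => hP⟩
    · exact ⟨0, fun h => absurd h he⟩
  choose P hP using hex
  have hsum : (liftHom hn I : PolyFun (n + 1)) = ∑ e ∈ s, P e :=
    (isLift_liftHom hn I).unique (hI ▸ isLift_sum s F P fun e he => (hP e he).2)
  -- Lifts of components of different bidegrees keep different bidegrees, since the degrees that
  -- occur are multiples of `n + 1`; vanishing can then be tested component by component on both
  -- sides.
  have hinj : Set.InjOn (fun e : ℤ × ℤ => (e.1 + e.1 / (n + 1 : ℕ), e.2 + e.1)) s := by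
    intro e he e' he' h
    obtain ⟨d, hd⟩ := succ_dvd_degree hn (hF e he).2 (hF e he).1
    obtain ⟨d', hd'⟩ := succ_dvd_degree hn (hF e' he').2 (hF e' he').1
    simp only [Prod.mk.injEq] at h
    have h0 : ((n + 1 : ℕ) : ℤ) ≠ 0 := by positivity
    have h1 := h.1
    rw [hd, hd', Int.mul_ediv_cancel_left _ h0, Int.mul_ediv_cancel_left _ h0] at h1
    have h2 : d = d' := by
      have h3 : (((n + 1 : ℕ) : ℤ) + 1) ≠ 0 := by positivity
      exact mul_left_cancel₀ h3 (by linarith)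
    have h4 : e.1 = e'.1 := by rw [hd, hd', h2]
    exact Prod.ext h4 (by have := h.2; omega)
  rw [vanishesOn_sum_iff s P _ hinj (fun e he => (hP e he).1) hsum a,
    vanishesOn_sum_iff s F id (Set.injOn_id _) (fun e he => (hF e he).1) hI b]
  exact forall₂_congr fun e he =>
    evalAt_isLift_eq_zero_iff hn (hF e he).1 (hP e he).2 a.2 hker hb

/-! ### Prime divisors and invariants of large slope -/

/-- Hilbert's Nullstellensatz for a principal prime ideal in arbitrarily many variables. -/
lemma dvd_of_evalAt_eq_zero {n : ℕ} {q f : PolyFun n} (hq : Prime q)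
    (h : ∀ a, evalAt a q = 0 → evalAt a f = 0) : q ∣ f := by
  obtain ⟨s, q', f', hq', hf'⟩ := MvPolynomial.exists_finset_rename₂ q f
  have hmem : f' ∈ (Ideal.span {q'}).radical := by
    rw [← MvPolynomial.vanishingIdeal_zeroLocus_eq_radical (K := ℂ),
      MvPolynomial.mem_vanishingIdeal_iff]
    intro x hx
    classical
    set y : Fin (n + 1) × ℕ → ℂ := fun v => if hv : v ∈ s then x ⟨v, hv⟩ else 0 with hy
    have hyx : y ∘ ((↑) : s → Fin (n + 1) × ℕ) = x := by
      funext v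
      simp [hy]
    have h1 (p : MvPolynomial s ℂ) :
        evalAt (ofCoords y) (MvPolynomial.rename (↑) p) = MvPolynomial.aeval x p := by
      rw [evalAt_ofCoords, MvPolynomial.eval_rename, hyx, MvPolynomial.aeval_eq_eval]
    rw [← h1, ← hf']
    refine h _ ?_
    rw [hq', h1]
    exact hx q' (Ideal.mem_span_singleton_self _)
  obtain ⟨k, hk⟩ := hmem
  rw [Ideal.mem_span_singleton] at hk
  refine hq.dvd_of_dvd_pow (n := k) ?_
  rw [hf', hq', ← map_pow]
  exact map_dvd _ hk

/-- Non-smooth series contain no hypersurface. As a factor of `wedge n 0 l`, `q` does not involve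
the coordinates with index `k`; specialising those in `wedge n 0 k` shows that `q` divides both `X
(0, 0)` and `X (0, 1)`. -/
lemma not_dvd_wedge_pair {n : ℕ} {q : PolyFun n} (hq : Prime q) {k l : Fin (n + 1)} (hk : k ≠ 0)
    (hl : l ≠ 0) (hkl : k ≠ l) (h1 : q ∣ wedge n 0 k) (h2 : q ∣ wedge n 0 l) : False := by
  have hl0 : wedge n 0 l ≠ 0 := wedge_ne_zero hl.symm
  have hvars (j : ℕ) : (k, j) ∉ q.vars := by
    classical
    rw [MvPolynomial.mem_vars_iff_degreeOf_ne_zero, not_not]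
    obtain ⟨r, hr⟩ := h2
    have hsupp : wedge n 0 l ∈ MvPolynomial.supported ℂ {v : Fin (n + 1) × ℕ | v.1 ≠ k} := by
      have hX (i : Fin (n + 1)) (j : ℕ) (hi : i ≠ k) : (MvPolynomial.X (i, j) : PolyFun n) ∈
          MvPolynomial.supported ℂ {v : Fin (n + 1) × ℕ | v.1 ≠ k} :=
        MvPolynomial.X_mem_supported.2 hi
      exact sub_mem (mul_mem (hX _ _ hk.symm) (hX _ _ hkl.symm))
        (mul_mem (hX _ _ hkl.symm) (hX _ _ hk.symm))
    have h3 : (wedge n 0 l).degreeOf (k, j) = 0 := by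
      by_contra h
      rw [← Ne, ← MvPolynomial.mem_vars_iff_degreeOf_ne_zero] at h
      exact (MvPolynomial.mem_supported.1 hsupp h) rfl
    rw [hr, MvPolynomial.degreeOf_mul_eq hq.ne_zero (by rintro rfl; simp [hl0] at hr)] at h3
    omega
  have key (α β : ℂ) : q ∣ MvPolynomial.C α * MvPolynomial.X (0, 0) -
      MvPolynomial.C β * MvPolynomial.X (0, 1) := by
    set θ : PolyFun n →ₐ[ℂ] PolyFun n := MvPolynomial.aeval fun v =>
      if v = (k, 1) then MvPolynomial.C α else if v = (k, 0) then MvPolynomial.C β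
        else MvPolynomial.X v with hθ
    have h3 : θ q = q := by
      conv_rhs => rw [← MvPolynomial.aeval_X_left_apply q]
      refine MvPolynomial.hom_congr_vars (f₁ := θ.toRingHom)
        (f₂ := (MvPolynomial.aeval MvPolynomial.X : PolyFun n →ₐ[ℂ] PolyFun n).toRingHom)
        (by ext; simp) (fun v hv _ => ?_) rfl
      have hv1 : v ≠ (k, 1) := fun h => hvars 1 (h ▸ hv)
      have hv0 : v ≠ (k, 0) := fun h => hvars 0 (h ▸ hv)
      simp [hθ, hv1, hv0]
    have h4 : θ q ∣ θ (wedge n 0 k) := map_dvd θ h1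
    rw [h3] at h4
    convert h4 using 1
    simp [hθ, wedge, hk.symm]
    ring
  have h5 := key 1 0
  have h6 := key 0 (-1)
  simp only [map_one, one_mul, map_zero, zero_mul, sub_zero, map_neg, neg_mul, sub_neg_eq_add,
    zero_add] at h5 h6
  have h7 := (hq.irreducible.associated_of_dvd
    (MvPolynomial.X_prime (R := ℂ) (i := ((0 : Fin (n + 1)), 0))).irreducible h5).symm.dvd.trans h6
  rw [MvPolynomial.X_dvd_X] at h7
  simp at h7

lemma exists_natCast_mem_of_prime {n : ℕ} (hn : 0 < n) {q : PolyFun n} (hq : Prime q)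
    {δ ϖ : ℤ} {f : PolyFun n} (hf : f ∈ invariants n δ ϖ) (hf0 : f ≠ 0) (hqf : q ∣ f) :
    ∃ δ' ϖ' : ℕ, q ∈ invariants n δ' ϖ' ∧ 0 < δ' := by
  obtain ⟨δ', ϖ', h⟩ := exists_mem_invariants_of_dvd hn hf hf0 hqf
  refine ⟨δ', ϖ', h, Nat.pos_of_ne_zero ?_⟩
  rintro rfl
  have h1 := eq_C_of_mem_invariants_zero hn (by simpa using h)
  refine hq.not_isUnit ?_
  rw [h1]
  refine (IsUnit.mk0 _ fun h0 => hq.ne_zero ?_).map MvPolynomial.C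
  rw [h1, h0, map_zero]

lemma pow_mem_invariants {n : ℕ} {δ ϖ : ℤ} {f : PolyFun n} (hf : f ∈ invariants n δ ϖ) (k : ℕ) :
    f ^ k ∈ invariants n (k * δ) (k * ϖ) := by
  induction k with
  | zero => simpa using one_mem_invariants n
  | succ k ih =>
    rw [pow_succ]
    have h := mul_mem_invariants ih hf
    rwa [← add_one_mul, ← add_one_mul, ← Nat.cast_succ] at h

/-- For `n ≥ 2` the number of monomials of degree `m` grows at least quadratically in `m`; `m = 4 (R
+ 1)` is large enough to exceed the linear bound `2 m (R + 1)`. -/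
lemma lt_card_monomialExponents {n : ℕ} (hn : 2 ≤ n) (R : ℕ) :
    2 * (4 * (R + 1)) * (R + 1) < (monomialExponents n (4 * (R + 1))).card - 1 := by
  have h1 : (monomialExponents n (4 * (R + 1))).card =
      (n + 4 * (R + 1)).choose (4 * (R + 1)) := by
    rw [Finset.card_finsuppAntidiag_nat_eq_choose, Finset.card_univ, Fintype.card_fin]
    congr 1
    omega
  have h2 : (2 + 4 * (R + 1)).choose (4 * (R + 1)) ≤ (n + 4 * (R + 1)).choose (4 * (R + 1)) :=
    Nat.choose_le_choose _ (by omega)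
  have h3 : (2 + 4 * (R + 1)).choose (4 * (R + 1)) = (2 * R + 3) * (4 * R + 5) := by
    rw [← Nat.choose_symm_add, Nat.choose_two_right]
    have : 2 + 4 * (R + 1) - 1 = 4 * R + 5 := by omega
    rw [this]
    have : (2 + 4 * (R + 1)) * (4 * R + 5) = 2 * ((2 * R + 3) * (4 * R + 5)) := by ring
    rw [this, Nat.mul_div_cancel_left _ two_pos]
  rw [h3] at h2
  rw [h1]
  have h4 : 2 * (4 * (R + 1)) * (R + 1) + 1 < (2 * R + 3) * (4 * R + 5) := by nlinarith
  omega

/-- An osculant has degree `m K` and weight `K (K - 1) / 2`. Since `δq ≥ 1`, at most `m K` factors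
`q` can be removed, costing weight at most `m K ϖq`; the weight left still exceeds `C m K`. -/
lemma slope_estimate {m K k δq ϖq δ ϖ C : ℕ} (hδq : 0 < δq)
    (hcard : 2 * m * (ϖq + C + 1) < K - 1) (h2 : m * K = k * δq + δ)
    (h3 : K.choose 2 = k * ϖq + ϖ) : C * δ < ϖ := by
  have h4 : K.choose 2 * 2 = K * (K - 1) := by
    rw [Nat.choose_two_right, Nat.div_mul_cancel (Nat.even_mul_pred_self K).two_dvd]
  have h5 : K * (2 * m * (ϖq + C + 1)) < K * (K - 1) := Nat.mul_lt_mul_of_pos_left hcard (by omega)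
  have h6 : k ≤ m * K := by nlinarith
  have h7 : k * ϖq ≤ m * K * ϖq := Nat.mul_le_mul_right _ h6
  have h8 : C * δ ≤ C * (m * K) := Nat.mul_le_mul_left _ (by omega)
  have h9 : K * (2 * m * (ϖq + C + 1)) = 2 * (m * K * ϖq) + 2 * (C * (m * K)) + 2 * (m * K) := by
    ring
  omega

/-- There are differential invariants not divisible by `q` of arbitrarily large slope. -/
theorem exists_steep_not_dvd {n : ℕ} (hn : 2 ≤ n) {q : PolyFun n} (hq : Prime q) {δq ϖq : ℕ}
    (hδq : 0 < δq) (hqI : q ∈ invariants n δq ϖq) (C : ℕ) :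
    ∃ (J : PolyFun n) (δ ϖ : ℕ), J ∈ invariants n δ ϖ ∧ ¬ q ∣ J ∧ 0 < δ ∧ C * δ < ϖ := by
  have hn' : 0 < n := by omega
  obtain ⟨R, hR⟩ : ∃ R, R = ϖq + C := ⟨_, rfl⟩
  obtain ⟨m, hm⟩ : ∃ m, m = 4 * (R + 1) := ⟨_, rfl⟩
  have hcard : 2 * m * (R + 1) < (monomialExponents n m).card - 1 :=
    hm ▸ lt_card_monomialExponents hn R
  have h0 := exists_osculant_ne_zero n m
  obtain ⟨J, hJ, hqJ⟩ :=
    (FiniteMultiplicity.of_prime_left hq h0).exists_eq_pow_mul_and_not_dvd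
  generalize multiplicity q (osculant n m) = k at hJ
  have hJ0 : J ≠ 0 := fun h => hqJ (h ▸ dvd_zero q)
  have hmem := osculant_mem hn' m
  obtain ⟨δ, ϖ, hJI⟩ := exists_mem_invariants_of_dvd hn' hmem h0 (q := J)
    (hJ ▸ dvd_mul_left J _)
  have h1 := mul_mem_invariants (pow_mem_invariants hqI k) hJI
  rw [← hJ] at h1
  obtain ⟨h2, h3⟩ := bidegree_unique hn' h0 hmem h1
  generalize (monomialExponents n m).card = K at hcard h2 h3
  have hlt : C * δ < ϖ :=
    slope_estimate hδq (hR ▸ hcard) (by exact_mod_cast h2) (by exact_mod_cast h3)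
  refine ⟨J, δ, ϖ, hJI, hqJ, Nat.pos_of_ne_zero ?_, hlt⟩
  rintro rfl
  -- In degree zero `J` would be a non-zero constant, hence of weight zero, contrary to `hlt`.
  have h9 := eq_C_of_mem_invariants_zero hn' (by simpa using hJI)
  have h10 : J ∈ invariants n 0 0 := by
    rw [h9, ← mul_one (MvPolynomial.C _), ← MvPolynomial.smul_eq_C_mul]
    exact Submodule.smul_mem _ _ (one_mem_invariants n)
  have h11 := (bidegree_unique hn' hJ0 hJI h10).2
  omega

/-! ### Uniqueness on slices -/

/-- The restriction of polynomial functions to the arcs `slice b`. -/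
def sliceHom (n : ℕ) : PolyFun (n + 1) →ₐ[ℂ] PolyFun n :=
  MvPolynomial.aeval fun v => Fin.cases (MvPolynomial.C (PowerSeries.coeff v.2 1))
    (fun i => if v.2 = 0 then 0 else MvPolynomial.X (i, v.2 - 1)) v.1

lemma evalAt_sliceHom {n : ℕ} (b : Series n) (f : PolyFun (n + 1)) :
    evalAt b (sliceHom n f) = evalAt (slice b) f := by
  induction f using MvPolynomial.induction_on with
  | C c => simp [sliceHom]
  | add p q hp hq => rw [map_add, evalAt_add, evalAt_add, hp, hq]
  | mul_X p v hp =>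
    rw [map_mul, evalAt_mul, evalAt_mul, hp]
    congr 1
    obtain ⟨i, j⟩ := v
    rw [evalAt_X, sliceHom, MvPolynomial.aeval_X]
    refine Fin.cases ?_ (fun i => ?_) i
    · simp only [Fin.cases_zero, evalAt_C, slice, Fin.cons_zero]
    · cases j with
      | zero => simp [slice]
      | succ j => simp [slice, PowerSeries.coeff_succ_X_mul]

lemma isSmooth_slice {n : ℕ} {b : Series n} (hb : coeffVec 0 b ≠ 0) : IsSmooth (slice b) := by
  rw [IsSmooth, LinearIndependent.pair_iff, coeffVec_zero_slice,
    coeffVec_succ_slice b 0]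
  intro s t hst
  obtain ⟨i, hi⟩ := Function.ne_iff.1 hb
  have h0 := congrFun hst 0
  have h1 := congrFun hst i.succ
  simp only [Pi.add_apply, Pi.smul_apply, Pi.single_eq_same, Fin.cons_zero, Fin.cons_succ,
    smul_eq_mul, mul_one, mul_zero, add_zero, Pi.zero_apply, ne_eq, Fin.succ_ne_zero,
    not_false_eq_true, Pi.single_eq_of_ne, zero_add] at h0 h1
  exact ⟨h0, (mul_eq_zero.1 h1).resolve_right hi⟩

/-- `slice b` as a parametrised smooth arc. -/
def sliceArc {n : ℕ} (b : ParamArc n) : ParamArc (n + 1) :=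
  ⟨slice b.1, isSmooth_slice b.2.coeffVec_zero_ne⟩

lemma coe_sliceArc {n : ℕ} (b : ParamArc n) : (sliceArc b).1 = slice b.1 := rfl

lemma isProjectionFromPoint_slice {n : ℕ} (b : ParamArc n) :
    IsProjectionFromPoint (sliceArc b).germ b.germ := by
  refine ⟨_, b, LinearMap.funLeft ℂ ℂ Fin.succ, rfl, rfl, ?_, fun j => ?_⟩
  · ext x
    simp only [LinearMap.mem_ker, coe_sliceArc, coeffVec_zero_slice, Submodule.mem_span_singleton]
    constructor
    · intro h
      refine ⟨x 0, ?_⟩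
      funext i
      refine Fin.cases ?_ (fun i => ?_) i
      · simp
      · have := congrFun h i
        simp only [LinearMap.funLeft_apply, Pi.zero_apply] at this
        simp [this]
    · rintro ⟨c, rfl⟩
      funext i
      simp [LinearMap.funLeft_apply]
  · rw [coe_sliceArc, coeffVec_succ_slice]
    funext i
    simp [LinearMap.funLeft_apply]

section Uniqueness

variable {n : ℕ} {φ : invariantRing n →ₐ[ℂ] invariantRing (n + 1)} {δ ϖ : ℤ}
  {I J : invariantRing n}

/-- The restriction of `φ I` to the arcs `slice b`. -/
def slicedHom (φ : invariantRing n →ₐ[ℂ] invariantRing (n + 1)) : invariantRing n →ₐ[ℂ] PolyFun n :=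
  ((sliceHom n).comp (invariantRing (n + 1)).val).comp φ

lemma evalAt_slicedHom (I : invariantRing n) (b : Series n) :
    evalAt b (slicedHom φ I) = evalAt (slice b) (φ I : PolyFun (n + 1)) :=
  evalAt_sliceHom b _

lemma evalAt_slicedHom_eq_zero_iff
    (hφ : ∀ I : invariantRing n, IsBihomogeneous I → IsBihomogeneous (φ I))
    (hproj : HasProjectionProperty φ) (hI : (I : PolyFun n) ∈ invariants n δ ϖ) {b : Series n}
    (hb : IsSmooth b) : evalAt b (slicedHom φ I) = 0 ↔ evalAt b (I : PolyFun n) = 0 := by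
  obtain ⟨δ', ϖ', h⟩ := hφ I ⟨δ, ϖ, hI⟩
  obtain ⟨β, rfl⟩ : ∃ β : ParamArc n, β.1 = b := ⟨⟨b, hb⟩, rfl⟩
  have h1 := hproj I _ _ (isProjectionFromPoint_slice β)
  rw [vanishesOn_germ_iff h, vanishesOn_germ_iff hI, coe_sliceArc] at h1
  rwa [evalAt_slicedHom]

lemma slicedHom_ne_zero (hn : 0 < n)
    (hφ : ∀ I : invariantRing n, IsBihomogeneous I → IsBihomogeneous (φ I))
    (hproj : HasProjectionProperty φ) (hI : (I : PolyFun n) ∈ invariants n δ ϖ)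
    (hI0 : (I : PolyFun n) ≠ 0) : slicedHom φ I ≠ 0 := by
  obtain ⟨b, hb⟩ := exists_evalAt_ne_zero (mul_ne_zero hI0 (wedge_zero_last_ne_zero hn))
  rw [evalAt_mul] at hb
  intro h
  refine left_ne_zero_of_mul hb ((evalAt_slicedHom_eq_zero_iff hφ hproj hI
    (isSmooth_of_evalAt_wedge (right_ne_zero_of_mul hb))).1 ?_)
  rw [h, evalAt_zero]

/-- The pencil argument: at a point `b` where `J` does not vanish, `I - z J` vanishes for `z = I(b)
/ J(b)`. Hence so does its image, and linearity gives the same ratio for the images. -/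
lemma slicedHom_mul_comm (hn : 0 < n)
    (hφ : ∀ I : invariantRing n, IsBihomogeneous I → IsBihomogeneous (φ I))
    (hproj : HasProjectionProperty φ) (hI : (I : PolyFun n) ∈ invariants n δ ϖ)
    (hJ : (J : PolyFun n) ∈ invariants n δ ϖ) :
    slicedHom φ I * (J : PolyFun n) = slicedHom φ J * (I : PolyFun n) := by
  refine eq_of_evalAt_of_ne_zero (wedge_zero_last_ne_zero hn) fun b hb => ?_
  have hb' := isSmooth_of_evalAt_wedge hb
  rw [evalAt_mul, evalAt_mul]
  by_cases hJb : evalAt b (J : PolyFun n) = 0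
  · rw [hJb, (evalAt_slicedHom_eq_zero_iff hφ hproj hJ hb').2 hJb, mul_zero, zero_mul]
  set z := evalAt b (I : PolyFun n) / evalAt b (J : PolyFun n) with hz
  have hK : ((I - z • J : invariantRing n) : PolyFun n) ∈ invariants n δ ϖ :=
    sub_mem hI (Submodule.smul_mem _ z hJ)
  have h := (evalAt_slicedHom_eq_zero_iff hφ hproj hK hb').2 (by
    simp only [AddSubgroupClass.coe_sub, SetLike.val_smul, evalAt_sub, evalAt_smul]
    rw [hz, div_mul_cancel₀ _ hJb, sub_self])
  rw [map_sub, map_smul, evalAt_sub, evalAt_smul, sub_eq_zero] at h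
  rw [h, hz]
  field_simp

/-- If `q` divided the image, `I` would vanish at the smooth zeros of `q`. Then `q` divides `I`
times each Plücker coordinate `wedge n 0 l`, hence all these coordinates, which is impossible. -/
lemma not_dvd_slicedHom (hn : 2 ≤ n)
    (hφ : ∀ I : invariantRing n, IsBihomogeneous I → IsBihomogeneous (φ I))
    (hproj : HasProjectionProperty φ) (hI : (I : PolyFun n) ∈ invariants n δ ϖ)
    {q : PolyFun n} (hq : Prime q) (hqI : ¬ q ∣ (I : PolyFun n)) : ¬ q ∣ slicedHom φ I := by
  intro h
  have key (l : Fin (n + 1)) : q ∣ wedge n 0 l := by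
    refine (hq.dvd_or_dvd (dvd_of_evalAt_eq_zero hq (f := (I : PolyFun n) * wedge n 0 l)
      fun b hb => ?_)).resolve_left hqI
    by_contra h1
    rw [evalAt_mul] at h1
    refine left_ne_zero_of_mul h1 ((evalAt_slicedHom_eq_zero_iff hφ hproj hI
      (isSmooth_of_evalAt_wedge (right_ne_zero_of_mul h1))).1 ?_)
    obtain ⟨r, hr⟩ := h
    rw [hr, evalAt_mul, hb, zero_mul]
  exact not_dvd_wedge_pair hq (k := ⟨1, by omega⟩) (l := ⟨2, by omega⟩) (by simp [Fin.ext_iff])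
    (by simp [Fin.ext_iff]) (by simp [Fin.ext_iff]) (key _) (key _)

/-- The element of the invariant ring defined by a differential invariant. -/
abbrev toRing {f : PolyFun n} (hf : f ∈ invariants n δ ϖ) : invariantRing n :=
  ⟨f, mem_invariantRing_of_mem hf⟩

lemma emultiplicity_slicedHom (hn : 2 ≤ n)
    (hφ : ∀ I : invariantRing n, IsBihomogeneous I → IsBihomogeneous (φ I))
    (hproj : HasProjectionProperty φ) (hI : (I : PolyFun n) ∈ invariants n δ ϖ)
    (hI0 : (I : PolyFun n) ≠ 0) {q : PolyFun n} (hq : Prime q) :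
    emultiplicity q (slicedHom φ I) = emultiplicity q (I : PolyFun n) := by
  have hn' : 0 < n := by omega
  by_cases hqI : q ∣ (I : PolyFun n)
  swap
  · rw [emultiplicity_eq_zero.2 hqI,
      emultiplicity_eq_zero.2 (not_dvd_slicedHom hn hφ hproj hI hq hqI)]
  obtain ⟨δq, ϖq, hqH, hδq⟩ := exists_natCast_mem_of_prime hn' hq hI hI0 hqI
  obtain ⟨δ₀, ϖ₀, hI'⟩ := exists_mem_invariants_of_dvd hn' hI hI0 dvd_rfl
  obtain ⟨J₁, δ₁, ϖ₁, hJ₁, hqJ₁, hδ₁, -⟩ := exists_steep_not_dvd hn hq hδq hqH 0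
  obtain ⟨J₂, δ₂, ϖ₂, hJ₂, hqJ₂, hδ₂, hlt⟩ := exists_steep_not_dvd hn hq hδq hqH ϖ₁
  have hlt' : δ₂ * ϖ₁ < δ₁ * ϖ₂ := by nlinarith
  obtain ⟨D, hD⟩ := Nat.exists_eq_add_of_lt hlt'
  rw [add_assoc] at hD
  have hD' : (δ₁ * ϖ₂ : ℤ) = δ₂ * ϖ₁ + (D + 1 : ℕ) := by exact_mod_cast hD
  -- Cramer's rule: `D + 1` is the determinant of the bidegrees of `J₁` and `J₂`, so `D + 1` times
  -- the bidegree of `I` is an integral combination of them. The negative terms are moved to the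
  -- side of `I`, giving `x` and `y` of equal bidegree; only `I` contributes multiplicity of `q`.
  set x := I ^ (D + 1) * (toRing hJ₁ ^ (ϖ₀ * δ₂) * toRing hJ₂ ^ (ϖ₁ * δ₀)) with hx
  set y := toRing hJ₁ ^ (δ₀ * ϖ₂) * toRing hJ₂ ^ (δ₁ * ϖ₀) with hy
  have hxm := mul_mem_invariants (pow_mem_invariants hI' (D + 1))
    (mul_mem_invariants (pow_mem_invariants hJ₁ (ϖ₀ * δ₂)) (pow_mem_invariants hJ₂ (ϖ₁ * δ₀)))
  have hym := mul_mem_invariants (pow_mem_invariants hJ₁ (δ₀ * ϖ₂))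
    (pow_mem_invariants hJ₂ (δ₁ * ϖ₀))
  have e1 : ((D + 1 : ℕ) : ℤ) * δ₀ + ((ϖ₀ * δ₂ : ℕ) * δ₁ + (ϖ₁ * δ₀ : ℕ) * δ₂) =
      (δ₀ * ϖ₂ : ℕ) * δ₁ + (δ₁ * ϖ₀ : ℕ) * δ₂ := by
    rw [eq_sub_of_add_eq' hD'.symm]
    push_cast
    ring
  have e2 : ((D + 1 : ℕ) : ℤ) * ϖ₀ + ((ϖ₀ * δ₂ : ℕ) * ϖ₁ + (ϖ₁ * δ₀ : ℕ) * ϖ₂) =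
      (δ₀ * ϖ₂ : ℕ) * ϖ₁ + (δ₁ * ϖ₀ : ℕ) * ϖ₂ := by
    rw [eq_sub_of_add_eq' hD'.symm]
    push_cast
    ring
  rw [e1, e2] at hxm
  have key := congrArg (emultiplicity q) (slicedHom_mul_comm hn' hφ hproj (I := x) (J := y) hxm hym)
  have z₁ := emultiplicity_eq_zero.2 hqJ₁
  have z₂ := emultiplicity_eq_zero.2 hqJ₂
  have z₁' := emultiplicity_eq_zero.2 (not_dvd_slicedHom hn hφ hproj (I := toRing hJ₁) hJ₁ hq hqJ₁)
  have z₂' := emultiplicity_eq_zero.2 (not_dvd_slicedHom hn hφ hproj (I := toRing hJ₂) hJ₂ hq hqJ₂)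
  simp only [hx, hy, map_mul, map_pow, MulMemClass.coe_mul, SubmonoidClass.coe_pow,
    emultiplicity_mul hq, emultiplicity_pow hq, z₁, z₂, z₁', z₂', mul_zero, add_zero,
    zero_add] at key
  have f1 := FiniteMultiplicity.of_prime_left hq (slicedHom_ne_zero hn' hφ hproj hI hI0)
  have f2 := FiniteMultiplicity.of_prime_left hq hI0
  rw [f1.emultiplicity_eq_multiplicity, f2.emultiplicity_eq_multiplicity] at key ⊢
  norm_cast at key ⊢
  exact Nat.eq_of_mul_eq_mul_left D.succ_pos key

/-- Polynomials with equal multiplicity at every prime are associated, and the units are the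
non-zero constants. -/
theorem exists_slicedHom_eq_smul (hn : 2 ≤ n)
    (hφ : ∀ I : invariantRing n, IsBihomogeneous I → IsBihomogeneous (φ I))
    (hproj : HasProjectionProperty φ) (hI : (I : PolyFun n) ∈ invariants n δ ϖ)
    (hI0 : (I : PolyFun n) ≠ 0) : ∃ c : ℂˣ, slicedHom φ I = (c : ℂ) • (I : PolyFun n) := by
  have hψ := slicedHom_ne_zero (by omega) hφ hproj hI hI0
  have h1 : (I : PolyFun n) ∣ slicedHom φ I :=
    (UniqueFactorizationMonoid.dvd_iff_emultiplicity_le hI0).2 fun q hq =>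
      (emultiplicity_slicedHom hn hφ hproj hI hI0 hq).ge
  have h2 : slicedHom φ I ∣ (I : PolyFun n) :=
    (UniqueFactorizationMonoid.dvd_iff_emultiplicity_le hψ).2 fun q hq =>
      (emultiplicity_slicedHom hn hφ hproj hI hI0 hq).le
  obtain ⟨u, hu⟩ := associated_of_dvd_dvd h1 h2
  obtain ⟨c, hc, hc'⟩ := MvPolynomial.isUnit_iff_eq_C_of_isReduced.1 u.isUnit
  refine ⟨hc.unit, ?_⟩
  rw [← hu, hc', mul_comm, MvPolynomial.smul_eq_C_mul]
  rfl

end Uniqueness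

/-! ### From slices to all arcs -/

lemma exists_slice_eq {n : ℕ} {y : Series (n + 1)} (hy : coeffVec 0 y = Pi.single 0 1) :
    ∃ (u : PowerSeries ℂ) (b : Series n), PowerSeries.coeff 0 u = 1 ∧
      reparam u PowerSeries.X y = slice b := by
  have h0 : PowerSeries.coeff 0 (y 0) = 1 := by
    have := congrFun hy 0
    simpa [coeffVec] using this
  have hne : PowerSeries.constantCoeff (y 0) ≠ 0 := by simpa using ne_of_eq_of_ne h0 one_ne_zero
  have hX (f : PowerSeries ℂ) : PowerSeries.subst PowerSeries.X f = f := by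
    have := PowerSeries.map_algebraMap_eq_subst_X (S := ℂ) f
    rw [← this]
    simp
  refine ⟨(y 0)⁻¹, tailShift (reparam (y 0)⁻¹ PowerSeries.X y), by simpa using h0, ?_⟩
  funext i
  refine Fin.cases ?_ (fun i => ?_) i
  · simp [reparam, slice, hX, PowerSeries.inv_mul_cancel _ hne]
  · ext j
    simp only [slice, Fin.cons_succ]
    cases j with
    | zero =>
      have := congrFun hy i.succ
      simp only [coeffVec] at this
      simp [reparam, hX] at this ⊢
      exact Or.inr this
    | succ j => rw [PowerSeries.coeff_succ_X_mul, coeff_tailShift]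

/-- Slices meet a dense set of orbits: a unimodular matrix moves `a_0` to the first basis vector,
and division by the first coordinate gives a slice. That unit has constant term one and the
parameter is kept, so both characters are trivial and the bidegrees need not agree. -/
lemma eq_of_evalAt_slice {n : ℕ} {δ ϖ δ' ϖ' : ℤ} {f g : PolyFun (n + 1)}
    (hf : f ∈ invariants (n + 1) δ ϖ) (hg : g ∈ invariants (n + 1) δ' ϖ')
    (h : ∀ b : Series n, evalAt (slice b) f = evalAt (slice b) g) : f = g := by
  refine eq_of_evalAt_of_ne_zero (MvPolynomial.X_ne_zero (0, 0)) fun a ha => ?_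
  rw [evalAt_X] at ha
  have ha0 : coeffVec 0 a 0 ≠ 0 := ha
  rw [← evalAt_linAct_of_mem n.succ_pos hf a (chartSL ha0),
    ← evalAt_linAct_of_mem n.succ_pos hg a (chartSL ha0)]
  have hy : coeffVec 0 (linAct (chartSL ha0).1 a) = Pi.single 0 1 := by
    rw [coeffVec_linAct]
    exact sendsToFirst_chart ha0
  obtain ⟨u, b, hu, hb⟩ := exists_slice_eq hy
  have hu' : IsUnitSeries u := by
    rw [IsUnitSeries, hu]
    exact one_ne_zero
  have hX : IsParamChange PowerSeries.X := ⟨by simp, by simp⟩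
  have h1 := evalAt_reparam_of_mem n.succ_pos hf (linAct (chartSL ha0).1 a) hu' hX
  have h2 := evalAt_reparam_of_mem n.succ_pos hg (linAct (chartSL ha0).1 a) hu' hX
  rw [hu, PowerSeries.coeff_one_X, one_zpow, one_zpow, one_mul, one_mul, hb] at h1 h2
  rw [← h1, ← h2, h]

theorem exists_eq_smul_liftHom {n : ℕ} (hn : 2 ≤ n)
    {φ : invariantRing n →ₐ[ℂ] invariantRing (n + 1)}
    (hφ : ∀ I : invariantRing n, IsBihomogeneous I → IsBihomogeneous (φ I))
    (hproj : HasProjectionProperty φ) {I : invariantRing n} {d p : ℤ}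
    (hI : HasReducedBidegree I d p) (hI0 : I ≠ 0) :
    ∃ c : ℂˣ, φ I = (c : ℂ) • liftHom (by omega : 0 < n) I := by
  have hn' : 0 < n := by omega
  obtain ⟨c, hc⟩ := exists_slicedHom_eq_smul hn hφ hproj hI
    (fun h => hI0 (Subtype.ext h))
  obtain ⟨δ, ϖ, h⟩ := hφ I ⟨_, _, hI⟩
  refine ⟨c, Subtype.ext (eq_of_evalAt_slice h
    (Submodule.smul_mem _ (c : ℂ) (liftHom_hasReducedBidegree hn' hI)) fun b => ?_)⟩
  rw [← evalAt_slicedHom, hc, evalAt_smul, SetLike.val_smul, evalAt_smul, evalAt_slice_liftHom]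

/-! ### Extending multiplicative functions to characters of `ℤ × ℤ` -/

section Extension

lemma exists_zpow_eq_of_ne_zero (τ : ℂˣ) {g : ℤ} (hg : g ≠ 0) : ∃ t : ℂˣ, t ^ g = τ := by
  obtain ⟨c, hc⟩ := IsAlgClosed.exists_pow_nat_eq (τ : ℂ) (Int.natAbs_pos.2 hg)
  have hc0 : c ≠ 0 := by
    rintro rfl
    rw [zero_pow (Int.natAbs_ne_zero.2 hg)] at hc
    exact τ.ne_zero hc.symm
  have h1 : Units.mk0 c hc0 ^ g.natAbs = τ := Units.ext (by simpa using hc)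
  rcases Int.natAbs_eq g with h | h
  · exact ⟨Units.mk0 c hc0, by rw [h, zpow_natCast, h1]⟩
  · exact ⟨(Units.mk0 c hc0)⁻¹, by rw [h, zpow_neg, zpow_natCast, inv_pow, inv_inv, h1]⟩

/-- A multiplicative function on a submonoid of `ℤ` with values in `ℂˣ` extends to `ℤ`. -/
lemma exists_zpow_of_multiplicative {R : ℤ → ℂˣ → Prop} (h0 : R 0 1)
    (hmul : ∀ {p p' τ τ'}, R p τ → R p' τ' → R (p + p') (τ * τ'))
    (hfun : ∀ {p τ τ'}, R p τ → R p τ' → τ = τ') : ∃ t : ℂˣ, ∀ p τ, R p τ → τ = t ^ p := by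
  -- The group of differences of points of the graph. Its fibre over `0` is trivial by `hfun`, so it
  -- is the graph of a character of a cyclic subgroup of `ℤ`; a root of the value at a generator
  -- extends that character.
  let H : AddSubgroup (ℤ × Additive ℂˣ) :=
    { carrier := {x | ∃ p p' τ τ', R p τ ∧ R p' τ' ∧ x = (p - p', Additive.ofMul (τ / τ'))}
      zero_mem' := ⟨0, 0, 1, 1, h0, h0, by rw [sub_self, div_self', ofMul_one, Prod.mk_zero_zero]⟩
      add_mem' := by
        rintro _ _ ⟨p, p', τ, τ', h, h', rfl⟩ ⟨q, q', σ, σ', k, k', rfl⟩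
        refine ⟨p + q, p' + q', τ * σ, τ' * σ', hmul h k, hmul h' k', ?_⟩
        rw [Prod.mk_add_mk, ← ofMul_mul, div_mul_div_comm, add_sub_add_comm]
      neg_mem' := by
        rintro _ ⟨p, p', τ, τ', h, h', rfl⟩
        refine ⟨p', p, τ', τ, h', h, ?_⟩
        rw [Prod.neg_mk, ← ofMul_inv, inv_div, neg_sub] }
  have hH (p τ) (h : R p τ) : (p, Additive.ofMul τ) ∈ H := ⟨p, 0, τ, 1, h, h0, by simp⟩
  have hzero (x : Additive ℂˣ) (h : ((0 : ℤ), x) ∈ H) : x = 0 := by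
    obtain ⟨p, p', τ, τ', h, h', he⟩ := h
    rw [Prod.mk.injEq] at he
    obtain rfl : p = p' := by omega
    rw [he.2, hfun h h', div_self', ofMul_one]
  obtain ⟨g, hg⟩ := Int.subgroup_cyclic (H.map (AddMonoidHom.fst ℤ (Additive ℂˣ)))
  rw [← AddSubgroup.zmultiples_eq_closure] at hg
  obtain ⟨⟨g', τ⟩, hgH, hgg⟩ : g ∈ H.map (AddMonoidHom.fst ℤ (Additive ℂˣ)) := by
    rw [hg]
    exact AddSubgroup.mem_zmultiples g
  obtain rfl : g' = g := hgg
  obtain ⟨t, ht⟩ : ∃ t : ℂˣ, t ^ g' = τ.toMul := by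
    rcases eq_or_ne g' 0 with rfl | hne
    · exact ⟨1, by rw [hzero τ hgH]; simp⟩
    · exact exists_zpow_eq_of_ne_zero _ hne
  refine ⟨t, fun p σ h => ?_⟩
  have hp : p ∈ H.map (AddMonoidHom.fst ℤ (Additive ℂˣ)) := ⟨_, hH p σ h, rfl⟩
  rw [hg, AddSubgroup.mem_zmultiples_iff] at hp
  obtain ⟨k, rfl⟩ := hp
  have h1 := sub_mem (hH _ σ h) (zsmul_mem hgH k)
  rw [Prod.smul_mk, Prod.mk_sub_mk, sub_self] at h1
  have h2 := sub_eq_zero.1 (hzero _ h1)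
  have h3 := congrArg Additive.toMul h2
  rw [toMul_ofMul, toMul_zsmul, ← ht, ← zpow_mul] at h3
  rw [h3, smul_eq_mul, mul_comm]

/-- A multiplicative function on a submonoid of `ℤ × ℤ` containing `(1, 0)`, with values in `ℂˣ`,
extends to `ℤ × ℤ`. -/
lemma exists_zpow_mul_zpow_of_multiplicative {R : ℤ → ℤ → ℂˣ → Prop} {s : ℂˣ} (h0 : R 0 0 1)
    (h1 : R 1 0 s)
    (hmul : ∀ {d p z d' p' z'}, R d p z → R d' p' z' → R (d + d') (p + p') (z * z'))
    (hfun : ∀ {d p z z'}, R d p z → R d p z' → z = z') :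
    ∃ t : ℂˣ, ∀ d p z, R d p z → z = s ^ d * t ^ p := by
  have hs {d p z} (h : R d p z) (k : ℕ) : R (d + k) p (z * s ^ k) := by
    induction k with
    | zero => simpa using h
    | succ k ih =>
      have := hmul ih h1
      rwa [add_zero, mul_assoc, ← pow_succ, add_assoc, ← Nat.cast_succ] at this
  -- Dividing by `s ^ d` leaves a function of `p` alone: values with the same `p` but different `d`
  -- are compared after multiplication by powers of the element over `(1, 0)`.
  obtain ⟨t, ht⟩ := exists_zpow_of_multiplicative (R := fun p τ => ∃ d, R d p (τ * s ^ d))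
    ⟨0, by simpa using h0⟩
    (by
      rintro p p' τ τ' ⟨d, h⟩ ⟨d', h'⟩
      refine ⟨d + d', ?_⟩
      rw [zpow_add, mul_mul_mul_comm]
      exact hmul h h')
    (by
      rintro p τ τ' ⟨d, h⟩ ⟨d', h'⟩
      have k := hs h (d' - d).toNat
      have k' := hs h' (d - d').toNat
      have e : d + (d' - d).toNat = d' + (d - d').toNat := by omega
      rw [mul_assoc, ← zpow_natCast, ← zpow_add, e] at k
      rw [mul_assoc, ← zpow_natCast, ← zpow_add] at k'
      exact mul_right_cancel (hfun k k'))
  refine ⟨t, fun d p z h => ?_⟩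
  rw [← ht p (z * s ^ (-d)) ⟨d, by rwa [mul_assoc, ← zpow_add, neg_add_cancel, zpow_zero, mul_one]⟩,
    mul_comm z, ← mul_assoc, ← zpow_add, add_neg_cancel, zpow_zero, one_mul]

end Extension

/-! ### The rescaling factor as a character -/

lemma HasReducedBidegree.mul {n : ℕ} {I J : invariantRing n} {d p d' p' : ℤ}
    (hI : HasReducedBidegree I d p) (hJ : HasReducedBidegree J d' p') :
    HasReducedBidegree (I * J) (d + d') (p + p') := by
  have h := mul_mem_invariants hI hJ
  rw [HasReducedBidegree, mul_add, mul_add, add_add_add_comm]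
  exact h

/-- The osculant for `m = 1` is, up to sign, the determinant of `a_0, …, a_n`, of degree `n + 1` and
weight `(n + 1).choose 2`. -/
lemma exists_hasReducedBidegree_one_zero {n : ℕ} (hn : 0 < n) :
    ∃ I : invariantRing n, I ≠ 0 ∧ HasReducedBidegree I 1 0 := by
  have hcard : (monomialExponents n 1).card = n + 1 := by
    rw [Finset.card_finsuppAntidiag_nat_eq_choose]
    simp
  have h := osculant_mem hn 1
  refine ⟨⟨_, mem_invariantRing_of_mem h⟩, fun h0 => exists_osculant_ne_zero n 1 ?_, ?_⟩
  · exact congrArg Subtype.val h0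
  · rw [HasReducedBidegree]
    rw [hcard] at h
    convert h using 2 <;> simp

theorem exists_eq_zpow_mul_zpow_smul_liftHom {n : ℕ} (hn : 2 ≤ n)
    {φ : invariantRing n →ₐ[ℂ] invariantRing (n + 1)}
    (hφ : ∀ I : invariantRing n, IsBihomogeneous I → IsBihomogeneous (φ I))
    (hproj : HasProjectionProperty φ) :
    ∃ s t : ℂˣ, ∀ (I : invariantRing n) (d p : ℤ), HasReducedBidegree I d p →
      φ I = ((s ^ d * t ^ p : ℂˣ) : ℂ) • liftHom (by omega : 0 < n) I := by
  have hn' : 0 < n := by omega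
  have hL0 {I : invariantRing n} (hI0 : I ≠ 0) : liftHom hn' I ≠ 0 :=
    (map_ne_zero_iff _ (liftHom_injective hn')).2 hI0
  obtain ⟨E, hE0, hE⟩ := exists_hasReducedBidegree_one_zero hn'
  obtain ⟨s, hs⟩ := exists_eq_smul_liftHom hn hφ hproj hE hE0
  obtain ⟨t, ht⟩ := exists_zpow_mul_zpow_of_multiplicative (s := s)
    (R := fun d p z => ∃ I : invariantRing n, I ≠ 0 ∧ HasReducedBidegree I d p ∧
      φ I = (z : ℂ) • liftHom hn' I)
    ⟨1, one_ne_zero, by simpa [HasReducedBidegree] using one_mem_invariants n, by simp⟩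
    ⟨E, hE0, hE, hs⟩
    (by
      rintro d p z d' p' z' ⟨I, hI0, hI, h⟩ ⟨J, hJ0, hJ, h'⟩
      refine ⟨I * J, mul_ne_zero hI0 hJ0, hI.mul hJ, ?_⟩
      rw [map_mul, map_mul, h, h', smul_mul_smul_comm, Units.val_mul])
    -- The factor depends on the reduced bidegree only: by `slicedHom_mul_comm`, `z I J = z' J I` in
    -- a domain.
    (by
      rintro d p z z' ⟨I, hI0, hI, h⟩ ⟨J, hJ0, hJ, h'⟩
      have hI0' : (I : PolyFun n) ≠ 0 := fun h => hI0 (Subtype.ext h)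
      have hJ0' : (J : PolyFun n) ≠ 0 := fun h => hJ0 (Subtype.ext h)
      have hc := slicedHom_mul_comm hn' hφ hproj hI hJ
      have hz {K : invariantRing n} {z : ℂˣ} (h : φ K = (z : ℂ) • liftHom hn' K) :
          slicedHom φ K = (z : ℂ) • (K : PolyFun n) := eq_of_evalAt fun b => by
        rw [evalAt_slicedHom, h, SetLike.val_smul, evalAt_smul, evalAt_smul, evalAt_slice_liftHom]
      rw [hz h, hz h', smul_mul_assoc, smul_mul_assoc, mul_comm (J : PolyFun n)] at hc
      exact Units.ext (smul_left_injective ℂ (mul_ne_zero hI0' hJ0') hc))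
  refine ⟨s, t, fun I d p hI => ?_⟩
  rcases eq_or_ne I 0 with rfl | hI0
  · simp
  · obtain ⟨c, hc⟩ := exists_eq_smul_liftHom hn hφ hproj hI hI0
    rw [hc, ← ht d p c ⟨I, hI0, hI, hc⟩]

end DiffInv

end

theorem mainTheorem3 (n : ℕ) (hn : 2 ≤ n) :
    ∃ ι : DiffInv.invariantRing n →ₐ[ℂ] DiffInv.invariantRing (n + 1),
      Function.Injective ι ∧
      DiffInv.HasProjectionProperty ι ∧
      (∀ (I : DiffInv.invariantRing n) (d p : ℤ),
        DiffInv.HasReducedBidegree I d p → DiffInv.HasReducedBidegree (ι I) d p) ∧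
      (∀ φ : DiffInv.invariantRing n →ₐ[ℂ] DiffInv.invariantRing (n + 1),
        (∀ I : DiffInv.invariantRing n,
          DiffInv.IsBihomogeneous I → DiffInv.IsBihomogeneous (φ I)) →
        DiffInv.HasProjectionProperty φ →
        ∃ s t : ℂˣ, ∀ (I : DiffInv.invariantRing n) (d p : ℤ),
          DiffInv.HasReducedBidegree I d p →
            φ I = ((s ^ d * t ^ p : ℂˣ) : ℂ) • ι I) :=
  have hn' : 0 < n := by omega
  ⟨DiffInv.liftHom hn', DiffInv.liftHom_injective hn', DiffInv.liftHom_hasProjectionProperty hn',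
    fun _ _ _ => DiffInv.liftHom_hasReducedBidegree hn',
    fun _ hφ hproj => DiffInv.exists_eq_zpow_mul_zpow_smul_liftHom hn hφ hproj⟩
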